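/- Let $q$ be a nonzero complex number that is not a root of unity (for instance $0<q<1$). Write $(a;q)_k=\prod_{i=0}^{k-1}(1-aq^i)$ and $(a,b;q)_k=(a;q)_k(b;q)_k$. For integers $n,m\ge 0$ put $$P_n(x_1,\dots,x_m)=\frac{(-q;q)_n^m}{(q;q)_n^m}\sum_{k_1,\dots,k_m=0}^n\ \prod_{1\le i<j\le m}\frac{q^{k_j}-q^{k_i}}{q^{k_j}+q^{k_i}}\ \prod_{i=1}^m\frac{(-q,q^{-n};q)_{k_i}}{(q,-q^{-n};q)_{k_i}}\,x_i^{k_i}.$$ Let $C_k(x;\beta|q)$ be the continuous $q$-ultraspherical polynomials, $$C_k(\cos\theta;\beta|q)=\sum_{l=0}^k\frac{(\beta;q)_l(\beta;q)_{k-l}}{(q;q)_l(q;q)_{k-l}}\cos((k-2l)\theta),$$ and let $c_k(x)=\frac{(q;q)_k}{(-q;q)_k}\,C_k(x/2;-q|q)$. They satisfy $c_k(-x)=(-1)^kc_k(x)$, so that for $N,m\ge 0$ $$\tilde{\mathbb P}_{N^m}(y_1,\dots,y_m)=\frac{\det_{1\le i,j\le m}\big(c_{N+2j-2}(y_i)\big)}{\prod_{1\le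 i<j\le m}(y_j^2-y_i^2)}$$ is a polynomial in $y_1,\dots,y_m$. (1) Suppose $m\le n+1$, let $x_1,\dots,x_m$ be nonzero complex numbers, fix any choice of square roots $\sqrt{-x_i}$, and put $\xi_i=\sqrt{-x_i}+(\sqrt{-x_i})^{-1}$. Then $$P_n(x_1,\dots,x_m)=\prod_{i=1}^m\frac{(-q;q)_{n+1-i}}{(q;q)_{n+1-i}}\big(\sqrt{-x_i}\big)^{n+1-m}\prod_{1\le i<j\le m}(x_j-x_i)\ \tilde{\mathbb P}_{(n+1-m)^m}(\xi_1,\dots,\xi_m).$$ (2) There is a unique linear functional $L$ on $\mathbb C[x]$ such that $L(c_jc_k)=0$ for $j\ne k$ and $L(1)=\frac{1-q}{1+q}$. Writing $\|c_k\|^2=L(c_k^2)$, one has $$\|c_k\|^2=\frac{(q;q)_k(q;q)_{k+1}}{(-q;q)_k(-q;q)_{k+1}}\qquad(k\ge0).$$ For $2m\le n+1$ let $$\tilde K_m^n(y_1,\dots,y_{2m})=\frac1{\prod_{i=1}^m\|c_{n+1-2i}\|^2}\ \frac{\det_{1\le i,j\le 2m}\big(c_{n-2m+2j-1}(y_i)\big)}{\prod_{1\le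 i<j\le 2m}(y_j^2-y_i^2)}$$ be the multivariable Christoffel--Darboux kernel of these polynomials. Then, for all nonzero complex numbers $x_1,\dots,x_{2m}$ and any choice of square roots $\sqrt{-x_i}$, with $\xi_i$ as in (1), $$P_n(x_1,\dots,x_{2m})=\prod_{i=1}^{2m}\big(\sqrt{-x_i}\big)^{n+1-2m}\prod_{1\le i<j\le 2m}(x_j-x_i)\ \tilde K_m^n(\xi_1,\dots,\xi_{2m}).$$ -/

import Mathlib

open Polynomial

noncomputable section

/-- The `q`-shifted factorial `(a; q)_k = (1 - a) (1 - a q) ⋯ (1 - a q^(k-1))`. -/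
def qPoch (a q : ℂ) (k : ℕ) : ℂ := ∏ i ∈ Finset.range k, (1 - a * q ^ i)

/-- The polynomials
`P_n(x_1, …, x_m) = ((-q;q)_n / (q;q)_n)^m ∑_{k_1, …, k_m = 0}^n
  ∏_{i < j} (q^{k_j} - q^{k_i}) / (q^{k_j} + q^{k_i})
  ∏_i ((-q;q)_{k_i} (q^{-n};q)_{k_i}) / ((q;q)_{k_i} (-q^{-n};q)_{k_i}) x_i^{k_i}`. -/
def multiP (q : ℂ) (n : ℕ) {m : ℕ} (x : Fin m → ℂ) : ℂ :=
  (qPoch (-q) q n ^ m / qPoch q q n ^ m) *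
    ∑ k : Fin m → Fin (n + 1),
      (∏ i : Fin m, ∏ j ∈ Finset.Ioi i,
          (q ^ (k j : ℕ) - q ^ (k i : ℕ)) / (q ^ (k j : ℕ) + q ^ (k i : ℕ))) *
        ∏ i : Fin m,
          (qPoch (-q) q (k i) * qPoch (q ^ n)⁻¹ q (k i)) /
            (qPoch q q (k i) * qPoch (-(q ^ n)⁻¹) q (k i)) * x i ^ (k i : ℕ)

/-- The continuous `q`-ultraspherical polynomial `C_n(x; β | q)`, determined by
`C_n(cos θ; β | q) = ∑_{k=0}^n ((β;q)_k (β;q)_{n-k}) / ((q;q)_k (q;q)_{n-k}) cos ((n - 2k) θ)`.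
Here `T` denotes the Chebyshev polynomials of the first kind, `T_l(cos θ) = cos (l θ)`, which are
indexed by all integers `l`. -/
def qUltraspherical (β q : ℂ) (n : ℕ) : ℂ[X] :=
  ∑ k ∈ Finset.range (n + 1),
    C ((qPoch β q k * qPoch β q (n - k)) / (qPoch q q k * qPoch q q (n - k))) *
      Chebyshev.T ℂ ((n : ℤ) - 2 * (k : ℤ))

/-- The monic polynomials `c_n(x) = (q;q)_n / (-q;q)_n C_n(x/2; -q | q)`. -/
def monicC (q : ℂ) (n : ℕ) : ℂ[X] :=
  C (qPoch q q n / qPoch (-q) q n) * (qUltraspherical (-q) q n).comp (C (1 / 2) * X)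

/-- A family of polynomials with `p_k(-x) = (-1)^k p_k(x)`. For monic orthogonal polynomials this
is the vanishing of all odd moments of the moment functional. -/
def HasParity (p : ℕ → ℂ[X]) : Prop :=
  ∀ k : ℕ, (p k).comp (-X) = (-1) ^ k * p k

/-- `det_{i,j} (p_{n + 2j - 2}(X_i))`, a polynomial in `m` variables
(the indices in `Fin m` start at `0`). -/
def rectNum (p : ℕ → ℂ[X]) (n m : ℕ) : MvPolynomial (Fin m) ℂ :=
  Matrix.det (Matrix.of fun i j : Fin m =>
    aeval (MvPolynomial.X i : MvPolynomial (Fin m) ℂ) (p (n + 2 * (j : ℕ))))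

/-- `∏_{i < j} (X_j^2 - X_i^2)`. -/
def rectDen (m : ℕ) : MvPolynomial (Fin m) ℂ :=
  ∏ i : Fin m, ∏ j ∈ Finset.Ioi i, (MvPolynomial.X j ^ 2 - MvPolynomial.X i ^ 2)

/-- A determinant of polynomial values is divisible by the Vandermonde product. -/
theorem prod_sub_dvd_det {R : Type*} [CommRing R] (m : ℕ) (y : Fin m → R) (g : Fin m → R[X]) :
    (∏ i : Fin m, ∏ j ∈ Finset.Ioi i, (y j - y i)) ∣
      Matrix.det (Matrix.of fun i j : Fin m => (g j).eval (y i)) := by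
  induction m with
  | zero => simp
  | succ m ih =>
    have hG : ∀ j, ∃ G : R[X], g j - C ((g j).eval (y 0)) = (X - C (y 0)) * G := fun j =>
      X_sub_C_dvd_sub_C_eval
    choose G hG using hG
    have hval : ∀ i j, (g j).eval (y i) = (y i - y 0) * (G j).eval (y i) + (g j).eval (y 0) := by
      intro i j
      have := congrArg (Polynomial.eval (y i)) (hG j)
      simp only [eval_sub, eval_C, eval_mul, eval_X] at this
      rw [← this]; ring
    let v : Fin (m + 1) → R := Fin.cons 1 (fun i' : Fin m => y i'.succ - y 0)
    let A : Matrix (Fin (m + 1)) (Fin (m + 1)) R := Matrix.of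
      (Fin.cons (fun j => (g j).eval (y 0)) (fun (i' : Fin m) j => (G j).eval (y i'.succ)) :
        Fin (m + 1) → Fin (m + 1) → R)
    have hdet : Matrix.det (Matrix.of fun i j : Fin (m + 1) => (g j).eval (y i)) =
        Matrix.det (Matrix.of fun i j : Fin (m + 1) => v i * A i j) := by
      refine Matrix.det_eq_of_forall_row_eq_smul_add_const
        (Fin.cons 0 (fun _ => 1) : Fin (m + 1) → R) 0 (by simp) ?_
      intro i j
      refine Fin.cases ?_ (fun i' => ?_) i
      · simp [v, A]
      · simp [v, A, hval i'.succ j]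
    rw [hdet, Matrix.det_mul_column, Fin.prod_univ_succ, Fin.prod_univ_succ]
    simp only [v, Fin.cons_zero, Fin.cons_succ, one_mul, Fin.prod_Ioi_zero, Fin.prod_Ioi_succ]
    refine mul_dvd_mul_left _ ?_
    rw [Matrix.det_succ_row_zero]
    refine Finset.dvd_sum fun j _ => Dvd.dvd.mul_left ?_ _
    exact ih (fun i => y i.succ) (fun k => G (j.succAbove k))

theorem exists_of_parity (p : ℂ[X]) (k e : ℕ) (he : k % 2 = e)
    (hp : p.comp (-X) = (-1) ^ k * p) : ∃ g : ℂ[X], p = X ^ e * g.comp (X ^ 2) := by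
  have hc : ∀ l, l % 2 ≠ e → p.coeff l = 0 := by
    intro l hl
    have h := congrArg (fun r => Polynomial.coeff r l) hp
    have h1 : ((-1 : ℂ[X]) ^ k * p) = C ((-1) ^ k) * p := by simp
    have h0 : (-X : ℂ[X]) = C (-1) * X := by simp
    simp only [h1, h0, coeff_C_mul, comp_C_mul_X_coeff] at h
    have h2 : ((-1 : ℂ) ^ l) = -(-1) ^ k := by
      rcases Nat.even_or_odd l with a | a <;> rcases Nat.even_or_odd k with b | b
      · rw [Nat.even_iff] at a b; omega
      · simp [a.neg_one_pow, b.neg_one_pow]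
      · simp [a.neg_one_pow, b.neg_one_pow]
      · rw [Nat.odd_iff] at a b; omega
    rw [h2] at h
    have h3 : ((-1 : ℂ) ^ k) ≠ 0 := pow_ne_zero _ (by norm_num)
    have h4 : (-1 : ℂ) ^ k * p.coeff l = 0 := by linear_combination (-1 / 2 : ℂ) * h
    exact (mul_eq_zero.mp h4).resolve_left h3
  have h2 : ∃ g : ℂ[X], g.comp (X ^ 2) = ∑ l ∈ Finset.range (p.natDegree + 1),
      C (p.coeff l) * X ^ (2 * (l / 2)) := by
    refine ⟨∑ l ∈ Finset.range (p.natDegree + 1), C (p.coeff l) * X ^ (l / 2), ?_⟩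
    simp [pow_mul]
  obtain ⟨g, hg⟩ := h2
  refine ⟨g, ?_⟩
  rw [hg, Finset.mul_sum]
  conv_lhs => rw [p.as_sum_range_C_mul_X_pow]
  refine Finset.sum_congr rfl fun l _ => ?_
  by_cases hl : l % 2 = e
  · have h3 : (X : ℂ[X]) ^ l = X ^ e * X ^ (2 * (l / 2)) := by
      rw [← pow_add]
      congr 1
      omega
    rw [h3]
    ring
  · simp [hc l hl]

theorem rectDen_dvd_rectNum {p : ℕ → ℂ[X]} (hp : HasParity p) (n m : ℕ) :
    rectDen m ∣ rectNum p n m := by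
  have hg : ∀ j : Fin m, ∃ g : ℂ[X], p (n + 2 * (j : ℕ)) = X ^ (n % 2) * g.comp (X ^ 2) :=
    fun j => exists_of_parity _ (n + 2 * (j : ℕ)) _ (by omega) (hp _)
  choose g hg using hg
  have h : rectNum p n m = (∏ i : Fin m, (MvPolynomial.X i : MvPolynomial (Fin m) ℂ) ^ (n % 2)) *
      Matrix.det (Matrix.of fun i j : Fin m =>
        ((g j).map (algebraMap ℂ (MvPolynomial (Fin m) ℂ))).eval (MvPolynomial.X i ^ 2)) := by
    rw [← Matrix.det_mul_column, rectNum]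
    congr 1
    ext1 i j
    simp only [Matrix.of_apply, hg, map_mul, map_pow, aeval_X, aeval_comp, eval_map_algebraMap]
  rw [h]
  exact Dvd.dvd.mul_left (prod_sub_dvd_det m _ _) _

/-- The generalized rectangular Schur polynomial
`P̃_{n^m}(X_1, …, X_m) = det_{i,j} (p_{n + 2j - 2}(X_i)) / ∏_{i < j} (X_j^2 - X_i^2)`,
an exact quotient of polynomials. -/
def rectSchur {p : ℕ → ℂ[X]} (hp : HasParity p) (n m : ℕ) : MvPolynomial (Fin m) ℂ :=
  (rectDen_dvd_rectNum hp n m).choose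

theorem rectDen_mul_rectSchur {p : ℕ → ℂ[X]} (hp : HasParity p) (n m : ℕ) :
    rectDen m * rectSchur hp n m = rectNum p n m :=
  (rectDen_dvd_rectNum hp n m).choose_spec.symm

theorem monicC_parity (q : ℂ) : HasParity (monicC q) := by
  have hT : ∀ l : ℤ, (Chebyshev.T ℂ l).comp (-X) = C ((l.negOnePow : ℤ) : ℂ) * Chebyshev.T ℂ l := by
    intro l
    refine Polynomial.funext fun x => ?_
    simp
  have hneg : ∀ n k : ℕ, ((((n : ℤ) - 2 * (k : ℤ)).negOnePow : ℤ) : ℂ) = (-1) ^ n := by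
    intro n k
    rw [Int.negOnePow_sub, Int.negOnePow_two_mul]
    simp [Int.negOnePow]
  have hU : ∀ n, (qUltraspherical (-q) q n).comp (-X) = (-1) ^ n * qUltraspherical (-q) q n := by
    intro n
    simp only [qUltraspherical, Polynomial.sum_comp, mul_comp, C_comp, hT, hneg,
      Finset.mul_sum]
    refine Finset.sum_congr rfl fun k _ => ?_
    simp only [C_pow, C_neg, C_1]
    ring
  intro n
  have h1 : ((C (1 / 2 : ℂ) * X).comp (-X) : ℂ[X]) = (-X).comp (C (1 / 2) * X) := by simp
  rw [monicC, mul_comp, C_comp, comp_assoc, h1, ← comp_assoc, hU]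
  simp only [mul_comp, pow_comp, neg_comp, one_comp]
  ring

/-- `L` is the moment functional of the family `(p_k)`, normalized to have total mass `mass`:
the polynomials `p_k` are orthogonal with respect to `L` and `L(1) = mass`.
Integration against a measure of total mass `mass` with finite moments for which the `p_k` are
orthogonal is a functional of this kind. -/
def IsMomentFunctional (p : ℕ → ℂ[X]) (mass : ℂ) (L : ℂ[X] →ₗ[ℂ] ℂ) : Prop :=
  (∀ j k : ℕ, j ≠ k → L (p j * p k) = 0) ∧ L 1 = mass

/-- The multivariable Christoffel--Darboux kernel
`K̃_m^n(X_1, …, X_{2m}) = (∏_{i=1}^m ‖p_{n+1-2i}‖^2)⁻¹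
  det_{1 ≤ i, j ≤ 2m} (p_{n-2m+2j-1}(X_i)) / ∏_{1 ≤ i < j ≤ 2m} (X_j^2 - X_i^2)`
for `2m ≤ n + 1`, where `‖p_k‖^2 = L(p_k^2)`. -/
def kernelK {p : ℕ → ℂ[X]} (hp : HasParity p) (L : ℂ[X] →ₗ[ℂ] ℂ) (n m : ℕ) :
    MvPolynomial (Fin (2 * m)) ℂ :=
  MvPolynomial.C (∏ i ∈ Finset.Icc 1 m, L (p (n + 1 - 2 * i) ^ 2))⁻¹ *
    rectSchur hp (n + 1 - 2 * m) (2 * m)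

end

/-!
Put `w_k = (-q; q)_k / (q; q)_k`. In the variables `t_i = -x_i = s_i ^ 2` the prefactor of `P_n`
can be absorbed, and `P_n` becomes `∑_k ∏_{i<j} (q^{k_j} - q^{k_i}) / (q^{k_j} + q^{k_i})
∏_i w_{k_i} w_{n-k_i} t_i^{k_i}` (`multiP_eq_pairSum`), while `s^N c_N(s + 1 / s)` is
`∑_k w_k w_{N-k} s^{2k} / w_N` (`pow_mul_monicC_eval`).

For an even number of variables, Schur's Pfaffian identity (`schur_pfaffian`) turns the sum into the
Pfaffian of its two-variable cases. These satisfy a Christoffel–Darboux formula (`sum_pair_eq`): up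
to powers of `s_i` and a constant they equal `(a_i b_j - b_i a_j) / (s_i s_j - 1 / (s_i s_j))` with
`a_i = c_{n-1}(ξ_i)`, `b_i = c_{n+1}(ξ_i)`, `ξ_i = s_i + 1 / s_i`. The Pfaffian of such a matrix
times `∏_{i<j} (s_i s_j - 1 / (s_i s_j))` is the determinant with rows `a_i ξ_i^{2k}, b_i ξ_i^{2k}`,
`k < m / 2`. This and Schur's identity are two cases of `pfaffian_mul_prod_eq_det`, where Lagrange
interpolation of the first row of the determinant reproduces the expansion of the Pfaffian. The
three-term recurrence `c_{k+1} = x c_k - γ_k c_{k-1}` (`monicC_add_two`) makes the columns triangular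
in `c_{n-1}, c_{n+1}, c_{n-3}, c_{n+3}, …`, which gives the determinant of the theorem
(`det_pairPowMatrix_monicC`).

An odd number of variables reduces to an even one by adjoining a variable equal to `0` and raising
`n` by one (`pairSum_cons_zero`, `genDet_cons_zero`). All of this is done for points in general
position; the remaining points follow by continuity along lines (`eq_at_zero_of_eq_off_roots`).

For the second part, the recurrence yields existence and uniqueness of the moment functional and
`‖c_k‖² = γ_k ‖c_{k-1}‖²`, hence `‖c_k‖² = 1 / (w_k w_{k+1})`; the factors `w_n, …, w_{n+1-2m}` of
the first part then pair up to the squared norms of the kernel (`prod_qRatio_eq_inv_prod_sq`).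
-/

/-! ### Products over pairs of indices and a limit principle -/

theorem prod_pairs_succ {M : Type*} [CommMonoid M] {m : ℕ} (f : Fin (m + 1) → Fin (m + 1) → M) :
    ∏ i, ∏ j ∈ Finset.Ioi i, f i j =
      (∏ k : Fin m, f 0 k.succ) * ∏ i : Fin m, ∏ j ∈ Finset.Ioi i, f i.succ j.succ := by
  simp [Fin.prod_univ_succ, Fin.prod_Ioi_succ]

theorem prod_pairs_eq_ite {M : Type*} [CommMonoid M] {m : ℕ} (f : Fin m → Fin m → M) :
    ∏ i, ∏ j ∈ Finset.Ioi i, f i j = ∏ i, ∏ j, if i < j then f i j else 1 := by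
  refine Finset.prod_congr rfl fun i _ => ?_
  rw [← Finset.prod_filter]
  congr 1
  ext j
  simp

/-- A product of a symmetric function over all pairs, with the pairs containing `l` split off. -/
theorem prod_pairs_succAbove {M : Type*} [CommMonoid M] {m : ℕ}
    (f : Fin (m + 1) → Fin (m + 1) → M) (hf : ∀ i j, f i j = f j i) (l : Fin (m + 1)) :
    ∏ i, ∏ j ∈ Finset.Ioi i, f i j =
      (∏ k, f l (l.succAbove k)) *
        ∏ i : Fin m, ∏ j ∈ Finset.Ioi i, f (l.succAbove i) (l.succAbove j) := by
  simp only [prod_pairs_eq_ite]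
  rw [Fin.prod_univ_succAbove _ l, Fin.prod_univ_succAbove _ l]
  simp only [lt_irrefl, if_false, one_mul]
  have h : ∀ i : Fin m, (∏ j, if l.succAbove i < j then f (l.succAbove i) j else 1) =
      (if l.succAbove i < l then f (l.succAbove i) l else 1) *
        ∏ j : Fin m, if i < j then f (l.succAbove i) (l.succAbove j) else 1 := by
    intro i
    rw [Fin.prod_univ_succAbove _ l]
    simp only [Fin.succAbove_lt_succAbove_iff]
  simp only [h]
  rw [Finset.prod_mul_distrib, ← mul_assoc, ← Finset.prod_mul_distrib]
  congr 1
  refine Finset.prod_congr rfl fun k _ => ?_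
  rcases lt_or_gt_of_ne (Fin.succAbove_ne l k) with h | h
  · simp [h, h.not_gt, hf]
  · simp [h, h.not_gt]

/-- Two functions that are continuous at `0` and agree wherever a nonzero polynomial does not
vanish agree at `0`. -/
theorem eq_at_zero_of_eq_off_roots {f g : ℂ → ℂ} (hf : ContinuousAt f 0) (hg : ContinuousAt g 0)
    {p : ℂ[X]} (hp : p ≠ 0) (h : ∀ e, p.eval e ≠ 0 → f e = g e) : f 0 = g 0 := by
  have hev : ∀ᶠ e in nhdsWithin (0 : ℂ) {0}ᶜ, f e = g e := by
    have hfin : ((p.roots.toFinset : Set ℂ) \ {0}).Finite :=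
      (Finset.finite_toSet _).subset Set.sdiff_subset
    have h1 : ((p.roots.toFinset : Set ℂ) \ {0})ᶜ ∈ nhds (0 : ℂ) :=
      hfin.isClosed.compl_mem_nhds (by simp)
    filter_upwards [mem_nhdsWithin_of_mem_nhds h1, self_mem_nhdsWithin] with e he he0
    refine h e fun hr => he ⟨?_, he0⟩
    simp [hp, hr]
  refine tendsto_nhds_unique (l := nhdsWithin (0 : ℂ) {0}ᶜ)
    (hf.tendsto.mono_left nhdsWithin_le_nhds) ((hg.tendsto.mono_left nhdsWithin_le_nhds).congr' ?_)
  filter_upwards [hev] with e he using he.symm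

/-! ### Pfaffians -/

/-- The Pfaffian of an alternating matrix, defined by expansion along the first row. Only the
entries above the diagonal enter. The value is `0` in odd size. -/
def pfaffian {R : Type*} [CommRing R] : (m : ℕ) → (Fin m → Fin m → R) → R
  | 0, _ => 1
  | 1, _ => 0
  | m + 2, A => ∑ l : Fin (m + 1), (-1) ^ (l : ℕ) * A 0 l.succ *
      pfaffian m fun i j => A (l.succAbove i).succ (l.succAbove j).succ

/-- The matrix with rows `(a_i, b_i, a_i y_i, b_i y_i, a_i y_i ^ 2, b_i y_i ^ 2, …)`. -/
def pairPowMatrix {R : Type*} [CommRing R] {m : ℕ} (a b y : Fin m → R) :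
    Matrix (Fin m) (Fin m) R :=
  Matrix.of fun i j => (if (j : ℕ) % 2 = 0 then a i else b i) * y i ^ ((j : ℕ) / 2)

/-- Interchanging rows so that row `l + 1` becomes row `1`. -/
theorem det_pairPowMatrix_cons_cons {R : Type*} [CommRing R] {m : ℕ} (a₀ b₀ y₀ : R)
    (a b y : Fin (m + 1) → R) (l : Fin (m + 1)) :
    (pairPowMatrix (Fin.cons a₀ a : Fin (m + 2) → R) (Fin.cons b₀ b) (Fin.cons y₀ y)).det =
      (-1) ^ (l : ℕ) * (pairPowMatrix
        (Fin.cons a₀ (Fin.cons (a l) (a ∘ l.succAbove) : Fin (m + 1) → R) : Fin (m + 2) → R)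
        (Fin.cons b₀ (Fin.cons (b l) (b ∘ l.succAbove) : Fin (m + 1) → R))
        (Fin.cons y₀ (Fin.cons (y l) (y ∘ l.succAbove) : Fin (m + 1) → R))).det := by
  have key : ∀ f : Fin (m + 1) → R, (Fin.cons (f l) (f ∘ l.succAbove) : Fin (m + 1) → R) =
      f ∘ l.cycleRange.symm := by
    intro f
    funext k
    refine Fin.cases ?_ (fun k => ?_) k
    · simp
    · simp [Fin.cycleRange_symm_succ]
  rw [Matrix.det_succ_row_zero, Matrix.det_succ_row_zero, Finset.mul_sum]
  refine Finset.sum_congr rfl fun j _ => ?_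
  have h := Matrix.det_permute l.cycleRange.symm
    ((pairPowMatrix (Fin.cons a₀ a : Fin (m + 2) → R) (Fin.cons b₀ b) (Fin.cons y₀ y)).submatrix
      Fin.succ j.succAbove)
  have h2 : (((pairPowMatrix (Fin.cons a₀ a : Fin (m + 2) → R) (Fin.cons b₀ b)
      (Fin.cons y₀ y)).submatrix Fin.succ j.succAbove).submatrix l.cycleRange.symm id) =
      ((pairPowMatrix
        (Fin.cons a₀ (Fin.cons (a l) (a ∘ l.succAbove) : Fin (m + 1) → R) : Fin (m + 2) → R)
        (Fin.cons b₀ (Fin.cons (b l) (b ∘ l.succAbove) : Fin (m + 1) → R))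
        (Fin.cons y₀ (Fin.cons (y l) (y ∘ l.succAbove) : Fin (m + 1) → R))).submatrix
          Fin.succ j.succAbove) := by
    ext i k
    simp [pairPowMatrix, key]
  rw [h2, Equiv.Perm.sign_symm, Fin.sign_cycleRange] at h
  rw [h]
  have h3 : ((-1 : R) ^ (l : ℕ)) * (-1) ^ (l : ℕ) = 1 := by
    rw [← mul_pow]; simp
  simp only [pairPowMatrix, Matrix.of_apply, Fin.cons_zero]
  push_cast
  linear_combination (-(-1 : R) ^ (j : ℕ) * ((if (j : ℕ) % 2 = 0 then a₀ else b₀) *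
    y₀ ^ ((j : ℕ) / 2)) * ((Matrix.of fun (i j : Fin (m+2)) =>
      (if (j : ℕ) % 2 = 0 then (Fin.cons a₀ a : Fin (m + 2) → R) i else
        (Fin.cons b₀ b : Fin (m + 2) → R) i) *
        (Fin.cons y₀ y : Fin (m + 2) → R) i ^ ((j : ℕ) / 2)).submatrix Fin.succ j.succAbove).det) * h3

/-- If the first two rows share the value `Y` of `y`, subtracting `Y` times column `j` from column
`j + 2` leaves only the first two entries of these rows. -/
theorem det_pairPowMatrix_of_eq {R : Type*} [CommRing R] {m : ℕ} (a₀ a₁ b₀ b₁ Y : R)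
    (a b y : Fin m → R) :
    (pairPowMatrix (Fin.cons a₀ (Fin.cons a₁ a : Fin (m + 1) → R) : Fin (m + 2) → R)
        (Fin.cons b₀ (Fin.cons b₁ b : Fin (m + 1) → R))
        (Fin.cons Y (Fin.cons Y y : Fin (m + 1) → R))).det =
      (a₀ * b₁ - b₀ * a₁) * (∏ k, (y k - Y)) * (pairPowMatrix a b y).det := by
  -- the unipotent matrix of these column operations
  let U : Matrix (Fin (m + 2)) (Fin (m + 2)) R := Matrix.of fun i j =>
    if i = j then 1 else if (i : ℕ) + 2 = j then -Y else 0
  have hU : U.det = 1 := by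
    rw [Matrix.det_of_isUpperTriangular]
    · simp [U]
    · intro i j hij
      have h1 : j < i := hij
      have h2 : (j : ℕ) < i := h1
      simp only [U, Matrix.of_apply]
      rw [if_neg h1.ne', if_neg (by omega)]
  set M := pairPowMatrix (Fin.cons a₀ (Fin.cons a₁ a : Fin (m + 1) → R) : Fin (m + 2) → R)
        (Fin.cons b₀ (Fin.cons b₁ b : Fin (m + 1) → R))
        (Fin.cons Y (Fin.cons Y y : Fin (m + 1) → R)) with hM
  have hMU0 : ∀ i, (M * U) i 0 = M i 0 := by
    intro i
    rw [Matrix.mul_apply, Finset.sum_eq_single 0]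
    · simp [U]
    · intro b _ hb; simp [U, hb]
    · simp
  have hMU1 : ∀ i, (M * U) i 1 = M i 1 := by
    intro i
    rw [Matrix.mul_apply, Finset.sum_eq_single 1]
    · simp [U]
    · intro b _ hb; simp [U, hb]
    · simp
  have hMU2 : ∀ i (j : Fin m), (M * U) i j.succ.succ =
      M i j.succ.succ - Y * M i j.castSucc.castSucc := by
    intro i j
    have hne : j.succ.succ ≠ j.castSucc.castSucc := by
      intro h; have := congrArg Fin.val h; simp at this; omega
    rw [Matrix.mul_apply, Finset.sum_eq_add _ _ hne]
    · simp [U, hne.symm]; ring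
    · rintro c - ⟨h1, h2⟩
      have h3 : ¬ ((c : ℕ) + 2 = (j.succ.succ : Fin (m + 2))) := by
        intro h; apply h2; ext; simp at h ⊢; omega
      simp only [U, Matrix.of_apply]
      rw [if_neg h1, if_neg h3, mul_zero]
    · simp
    · simp
  have hrec : ∀ i (j : Fin m), M i j.succ.succ = (Fin.cons Y (Fin.cons Y y : Fin (m + 1) → R) :
      Fin (m + 2) → R) i * M i j.castSucc.castSucc := by
    intro i j
    simp only [hM, pairPowMatrix, Matrix.of_apply, Fin.val_succ, Fin.val_castSucc]
    simp only [show ((j : ℕ) + 1 + 1) % 2 = j % 2 by omega,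
      show ((j : ℕ) + 1 + 1) / 2 = j / 2 + 1 by omega]
    ring
  rw [← mul_one M.det, ← hU, ← Matrix.det_mul, Matrix.det_succ_row_zero, Fin.sum_univ_succ,
    Fin.sum_univ_succ, Finset.sum_eq_zero]
  swap
  · intro j _
    rw [hMU2, hrec]; simp
  have hsub : ∀ c : Fin (m + 2), (c = 0 ∨ c = 1) → ((M * U).submatrix Fin.succ c.succAbove).det =
      (if c = 0 then b₁ else a₁) * ((∏ k, (y k - Y)) * (pairPowMatrix a b y).det) := by
    intro c hc
    have hc2 : ∀ j : Fin m, c.succAbove j.succ = j.succ.succ := by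
      intro j
      rcases hc with rfl | rfl
      · simp
      · rw [Fin.succAbove_of_le_castSucc]
        simp [Fin.le_def]
    rw [Matrix.det_succ_row_zero, Fin.sum_univ_succ, Finset.sum_eq_zero]
    swap
    · intro j _
      simp only [Matrix.submatrix_apply, hc2, hMU2, hrec]
      simp
    have h0 : (M * U) 1 (c.succAbove 0) = if c = 0 then b₁ else a₁ := by
      rcases hc with rfl | rfl
      · simp only [Fin.succAbove_zero, Fin.succ_zero_eq_one, hMU1]
        simp [hM, pairPowMatrix]
      · have : (1 : Fin (m + 2)).succAbove 0 = 0 := by simp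
        rw [this, hMU0]
        simp [hM, pairPowMatrix]
    have h1 : (((M * U).submatrix Fin.succ c.succAbove).submatrix Fin.succ (Fin.succAbove 0)) =
        Matrix.of fun i j => (y i - Y) * pairPowMatrix a b y i j := by
      ext i j
      simp only [Matrix.submatrix_apply, Fin.succAbove_zero, hc2, hMU2, hrec, Matrix.of_apply,
        ← sub_mul]
      simp [hM, pairPowMatrix]
    rw [h1, Matrix.det_mul_column]
    simp [h0]
  rw [Fin.succ_zero_eq_one, hsub 0 (Or.inl rfl), hsub 1 (Or.inr rfl), hMU0, hMU1]
  simp [hM, pairPowMatrix]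
  ring

theorem det_pairPowMatrix_cons_eq_sum {R : Type*} [CommRing R] {m : ℕ} (a₀ b₀ y₀ : R)
    (a b y : Fin (m + 1) → R) (v κ : Fin (m + 1) → R)
    (h : ∀ c ≤ (m + 1) / 2, y₀ ^ c = ∑ l, κ l * v l ^ c) :
    (pairPowMatrix (Fin.cons a₀ a : Fin (m + 2) → R) (Fin.cons b₀ b) (Fin.cons y₀ y)).det =
      ∑ l, κ l * (pairPowMatrix (Fin.cons a₀ a : Fin (m + 2) → R) (Fin.cons b₀ b)
        (Fin.cons (v l) y)).det := by
  have hsub : ∀ Y (j : Fin (m + 2)), ((pairPowMatrix (Fin.cons a₀ a : Fin (m + 2) → R)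
      (Fin.cons b₀ b) (Fin.cons Y y)).submatrix Fin.succ j.succAbove) = Matrix.of fun i k =>
        (if (j.succAbove k : ℕ) % 2 = 0 then a i else b i) * y i ^ ((j.succAbove k : ℕ) / 2) := by
    intro Y j
    ext i k
    simp [pairPowMatrix]
  simp only [Matrix.det_succ_row_zero (n := m + 1), hsub, Finset.mul_sum]
  rw [Finset.sum_comm]
  refine Finset.sum_congr rfl fun j _ => ?_
  simp only [pairPowMatrix, Matrix.of_apply, Fin.cons_zero]
  rw [h ((j : ℕ) / 2) (by omega), Finset.mul_sum, Finset.mul_sum, Finset.sum_mul]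
  refine Finset.sum_congr rfl fun l _ => ?_
  ring

/-- A Pfaffian `Pf ((a_i b_j - b_i a_j) / ω_{ij})` times `∏ ω_{ij}` is a single determinant, when
the differences factor as `y_j - y_i = ω_{ij} δ_{ij}` and the powers of `y` of degree at most `m / 2`
satisfy a Lagrange interpolation formula on `m + 1` nodes, with weights `∏_k ω_{0k} / δ_{lk}`.
Interpolating the first row of the determinant at the other values of `y` gives two rows with equal
`y`, so that each summand splits off a `2 × 2` minor and becomes a term of the Pfaffian. -/
theorem pfaffian_mul_prod_eq_det {ι K : Type*} [Field K] (a b y : ι → K) (ω δ : ι → ι → K)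
    (hω : ∀ s t, ω s t = ω t s) (G : ι → ι → Prop)
    (hy : ∀ s t, G s t → y t - y s = ω s t * δ s t) (hG : ∀ s t, G s t → ω s t ≠ 0 ∧ δ s t ≠ 0)
    (interp : ∀ (m : ℕ), Even m → ∀ (s : ι) (p : Fin (m + 1) → ι), (∀ i, G s (p i)) →
      (∀ i j, i ≠ j → G (p i) (p j)) → ∀ c ≤ m / 2,
        y s ^ c = ∑ l, (∏ k : Fin m, ω s (p (l.succAbove k)) / δ (p l) (p (l.succAbove k))) *
          y (p l) ^ c) :
    ∀ (m : ℕ), Even m → ∀ p : Fin m → ι, (∀ i j, i ≠ j → G (p i) (p j)) →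
      pfaffian m (fun i j => (a (p i) * b (p j) - b (p i) * a (p j)) / ω (p i) (p j)) *
        (∏ i, ∏ j ∈ Finset.Ioi i, ω (p i) (p j)) =
      (pairPowMatrix (a ∘ p) (b ∘ p) (y ∘ p)).det
  | 0, _, p, _ => by simp [pfaffian]
  | 1, h, _, _ => by simp at h
  | m + 2, he, p, hp => by
    have hm : Even m := by
      rw [Nat.even_iff] at he ⊢; omega
    have hcons : ∀ f : ι → K, f ∘ p = (Fin.cons (f (p 0)) (fun i : Fin (m + 1) => f (p i.succ)) :
        Fin (m + 2) → K) := by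
      intro f; funext i
      refine Fin.cases ?_ (fun i => ?_) i <;> simp
    have hi := interp m hm (p 0) (fun i => p i.succ) (fun i => hp _ _ (Fin.succ_ne_zero i).symm)
      (fun i j hij => hp _ _ (fun h => hij (Fin.succ_injective _ h)))
    rw [hcons a, hcons b, hcons y, det_pairPowMatrix_cons_eq_sum _ _ _ _ _ _ _ _
      (fun c hc => hi c (by rw [Nat.even_iff] at hm; omega)), pfaffian, Finset.sum_mul]
    refine Finset.sum_congr rfl fun l _ => ?_
    rw [det_pairPowMatrix_cons_cons _ _ _ _ _ _ l, det_pairPowMatrix_of_eq, prod_pairs_succ,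
      prod_pairs_succAbove (fun i j : Fin (m + 1) => ω (p i.succ) (p j.succ)) (fun _ _ => hω _ _) l,
      Fin.prod_univ_succAbove _ l]
    have ih := pfaffian_mul_prod_eq_det a b y ω δ hω G hy hG interp m hm
      (fun i => p (l.succAbove i).succ) (fun i j hij => hp _ _ (fun h => hij
        (l.succAbove_right_injective (Fin.succ_injective _ h))))
    have e : ∀ f : ι → K, ((fun i : Fin (m + 1) => f (p i.succ)) ∘ l.succAbove) =
      f ∘ (fun i => p (l.succAbove i).succ) := fun f => rfl
    rw [e, e, e, ← ih]
    have hne := (hG _ _ (hp 0 l.succ (Fin.succ_ne_zero l).symm)).1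
    have hprod : (∏ k : Fin m, ω (p 0) (p (l.succAbove k).succ) /
        δ (p l.succ) (p (l.succAbove k).succ)) *
        (∏ k : Fin m, ((y ∘ fun i => p (l.succAbove i).succ) k - y (p l.succ))) =
        (∏ k : Fin m, ω (p 0) (p (l.succAbove k).succ)) *
          ∏ k : Fin m, ω (p l.succ) (p (l.succAbove k).succ) := by
      rw [← Finset.prod_mul_distrib, ← Finset.prod_mul_distrib]
      refine Finset.prod_congr rfl fun k _ => ?_
      have hk := hp l.succ (l.succAbove k).succ
        (fun h => Fin.succAbove_ne l k (Fin.succ_injective _ h).symm)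
      have hd := (hG _ _ hk).2
      simp only [Function.comp]
      rw [hy _ _ hk]
      field_simp
    field_simp
    linear_combination (-1) * (a (p 0) * b (p l.succ) - b (p 0) * a (p l.succ)) *
      (pfaffian m fun i j => (a (p (l.succAbove i).succ) * b (p (l.succAbove j).succ) -
        b (p (l.succAbove i).succ) * a (p (l.succAbove j).succ)) /
          ω (p (l.succAbove i).succ) (p (l.succAbove j).succ)) *
      (∏ i : Fin m, ∏ j ∈ Finset.Ioi i, ω (p (l.succAbove i).succ) (p (l.succAbove j).succ)) * hprod

theorem pfaffian_congr {R : Type*} [CommRing R] : ∀ (m : ℕ) {A B : Fin m → Fin m → R},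
    (∀ i j, i < j → A i j = B i j) → pfaffian m A = pfaffian m B
  | 0, _, _, _ => rfl
  | 1, _, _, _ => rfl
  | m + 2, A, B, h => by
    rw [pfaffian, pfaffian]
    refine Finset.sum_congr rfl fun l _ => ?_
    rw [h 0 l.succ (Fin.succ_pos l), pfaffian_congr m fun i j hij => h _ _
      (Fin.succ_lt_succ_iff.mpr ((Fin.strictMono_succAbove l) hij))]

theorem pfaffian_smul {R : Type*} [CommRing R] (c : R) : ∀ (m : ℕ) (v : Fin m → R)
    (A : Fin m → Fin m → R),
    pfaffian m (fun i j => c * v i * v j * A i j) = c ^ (m / 2) * (∏ i, v i) * pfaffian m A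
  | 0, _, _ => by simp [pfaffian]
  | 1, _, _ => by simp [pfaffian]
  | m + 2, v, A => by
    rw [pfaffian, pfaffian, Finset.mul_sum]
    refine Finset.sum_congr rfl fun l _ => ?_
    rw [pfaffian_smul c m (fun i => v (l.succAbove i).succ)
      (fun i j => A (l.succAbove i).succ (l.succAbove j).succ), Fin.prod_univ_succ,
      Fin.prod_univ_succAbove _ l, show (m + 2) / 2 = m / 2 + 1 by omega]
    ring

theorem continuousAt_pfaffian {X : Type*} [TopologicalSpace X] {x : X} : ∀ (m : ℕ)
    {A : X → Fin m → Fin m → ℂ}, (∀ i j, i < j → ContinuousAt (fun e => A e i j) x) →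
      ContinuousAt (fun e => pfaffian m (A e)) x
  | 0, _, _ => by simpa only [pfaffian] using continuousAt_const
  | 1, _, _ => by simpa only [pfaffian] using continuousAt_const
  | m + 2, A, h => by
    simp only [pfaffian]
    refine tendsto_finsetSum _ fun l _ => ?_
    refine (continuousAt_const.mul (h 0 l.succ (Fin.succ_pos l))).mul ?_
    exact continuousAt_pfaffian m fun i j hij => h _ _
      (Fin.succ_lt_succ_iff.mpr ((Fin.strictMono_succAbove l) hij))

/-- A Pfaffian summed against a product of weights is the Pfaffian of the pairwise sums. -/
theorem sum_pfaffian_mul_prod {R κ : Type*} [CommRing R] [Fintype κ] (A : κ → κ → R) :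
    ∀ (m : ℕ), Even m → ∀ φ : Fin m → κ → R,
      ∑ k : Fin m → κ, pfaffian m (fun i j => A (k i) (k j)) * ∏ i, φ i (k i) =
        pfaffian m fun i j => ∑ a, ∑ b, A a b * φ i a * φ j b
  | 0, _, φ => by simp [pfaffian]
  | 1, h, _ => by simp at h
  | m + 2, he, φ => by
    have hm : Even m := by
      rw [Nat.even_iff] at he ⊢; omega
    simp only [pfaffian, Finset.sum_mul]
    rw [Finset.sum_comm]
    refine Finset.sum_congr rfl fun l _ => ?_
    rw [← sum_pfaffian_mul_prod A m hm (fun i => φ (l.succAbove i).succ),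
      ← (Fin.consEquiv (fun _ : Fin (m + 2) => κ)).sum_comp, Fintype.sum_prod_type, mul_assoc,
      Finset.sum_mul, Finset.mul_sum]
    refine Finset.sum_congr rfl fun a _ => ?_
    rw [← (Fin.insertNthEquiv (fun _ : Fin (m + 1) => κ) l).sum_comp, Fintype.sum_prod_type,
      Finset.sum_mul, Finset.mul_sum]
    refine Finset.sum_congr rfl fun b _ => ?_
    rw [Finset.mul_sum, Finset.mul_sum]
    refine Finset.sum_congr rfl fun k _ => ?_
    rw [Fin.prod_univ_succ, Fin.prod_univ_succAbove _ l]
    simp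
    ring

/-! ### Lagrange interpolation and points in general position -/

theorem eval_eq_sum_lagrange {K : Type*} [Field K] {m : ℕ} (u : Fin (m + 1) → K)
    (hu : Function.Injective u) (P : K[X]) (hP : P.natDegree ≤ m) (x : K) :
    P.eval x = ∑ l, P.eval (u l) *
      ∏ k : Fin m, (x - u (l.succAbove k)) / (u l - u (l.succAbove k)) := by
  have h := Lagrange.eq_interpolate (s := Finset.univ) (v := u) (f := P) hu.injOn (by
    refine lt_of_le_of_lt degree_le_natDegree ?_
    rw [Finset.card_univ, Fintype.card_fin]
    exact_mod_cast Nat.lt_succ_of_le hP)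
  conv_lhs => rw [h, Lagrange.interpolate_apply, eval_finsetSum]
  refine Finset.sum_congr rfl fun l _ => ?_
  rw [eval_mul, eval_C, Lagrange.basis, eval_prod]
  congr 1
  have h2 : (Finset.univ.erase l) = Finset.univ.image l.succAbove := by
    rw [Fin.image_succAbove_univ]; ext; simp
  rw [h2, Finset.prod_image fun a _ b _ hab => l.succAbove_right_injective hab]
  refine Finset.prod_congr rfl fun k _ => ?_
  simp [Lagrange.basisDivisor, div_eq_inv_mul]

/-- Points on a line with direction `(1, 2, …, m)` are in general position off the zeros of a
nonzero polynomial in the parameter. -/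
theorem exists_poly_general_position {m : ℕ} (v : Fin m → ℂ) : ∃ p : ℂ[X], p ≠ 0 ∧
    ∀ e, p.eval e ≠ 0 → (∀ i : Fin m, v i + e * ((i : ℕ) + 1) ≠ 0) ∧
      ∀ i j : Fin m, i ≠ j →
        v i + e * ((i : ℕ) + 1) ≠ v j + e * ((j : ℕ) + 1) ∧
        (v i + e * ((i : ℕ) + 1)) + (v j + e * ((j : ℕ) + 1)) ≠ 0 ∧
        (v i + e * ((i : ℕ) + 1)) * (v j + e * ((j : ℕ) + 1)) ≠ 1 ∧
        (v i + e * ((i : ℕ) + 1)) * (v j + e * ((j : ℕ) + 1)) ≠ -1 := by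
  let L : Fin m → ℂ[X] := fun i => C ((i : ℂ) + 1) * X + C (v i)
  have hc : ∀ i : Fin m, ((i : ℕ) : ℂ) + 1 ≠ 0 := fun i => Nat.cast_add_one_ne_zero _
  have hdeg : ∀ i, (L i).degree = 1 := fun i => degree_linear (hc i)
  have hL : ∀ i, L i ≠ 0 := fun i h => by have := hdeg i; rw [h] at this; simp at this
  have h1 : ∀ i j, i ≠ j → L i - L j ≠ 0 := by
    intro i j hij h
    have h2 := congrArg (fun p : ℂ[X] => p.coeff 1) h
    simp [L, sub_eq_zero] at h2
    exact hij (Fin.ext h2)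
  have h2 : ∀ i j, L i + L j ≠ 0 := by
    intro i j h
    have h2 := congrArg (fun p : ℂ[X] => p.coeff 1) h
    simp [L] at h2
    have h3 : (((i : ℕ) + 1 + ((j : ℕ) + 1) : ℕ) : ℂ) = 0 := by push_cast; exact h2
    rw [Nat.cast_eq_zero] at h3
    omega
  have h3 : ∀ i j (c : ℂ), L i * L j - C c ≠ 0 := by
    intro i j c h
    have h4 : (L i * L j).degree = (C c).degree := by rw [sub_eq_zero.mp h]
    rw [degree_mul, hdeg, hdeg] at h4
    have h5 := degree_C_le (a := c)
    rw [← h4] at h5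
    norm_num at h5
  refine ⟨(∏ i, L i) * ∏ i, ∏ j ∈ Finset.univ.erase i,
    ((L i - L j) * (L i + L j) * (L i * L j - C 1) * (L i * L j - C (-1))), ?_, ?_⟩
  · refine mul_ne_zero (Finset.prod_ne_zero_iff.mpr fun i _ => hL i)
      (Finset.prod_ne_zero_iff.mpr fun i _ => Finset.prod_ne_zero_iff.mpr fun j hj => ?_)
    exact mul_ne_zero (mul_ne_zero (mul_ne_zero (h1 i j (Finset.ne_of_mem_erase hj).symm) (h2 i j))
      (h3 i j _)) (h3 i j _)
  · intro e he
    have hev : ∀ i, (L i).eval e = v i + e * ((i : ℕ) + 1) := by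
      intro i; simp [L]; ring
    rw [eval_mul, eval_prod, eval_prod] at he
    have he1 := Finset.prod_ne_zero_iff.mp (left_ne_zero_of_mul he)
    have he2 := Finset.prod_ne_zero_iff.mp (right_ne_zero_of_mul he)
    refine ⟨fun i => by rw [← hev]; exact he1 i (Finset.mem_univ _), fun i j hij => ?_⟩
    have he3 := he2 i (Finset.mem_univ _)
    rw [eval_prod] at he3
    have he4 := Finset.prod_ne_zero_iff.mp he3 j (Finset.mem_erase.mpr ⟨hij.symm, Finset.mem_univ _⟩)
    simp only [eval_mul, eval_sub, eval_add, eval_C, hev] at he4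
    refine ⟨fun h => he4 ?_, fun h => he4 ?_, fun h => he4 ?_, fun h => he4 ?_⟩
    · rw [h]; ring
    · rw [h]; ring
    · rw [h]; ring
    · rw [h]; ring

/-! ### Evaluation of two Pfaffians -/

theorem schur_pfaffian_of_general_position {m : ℕ} (hm : Even m) (z : Fin m → ℂ)
    (hz : ∀ i j, i ≠ j → z i + z j ≠ 0 ∧ z i ≠ z j) :
    pfaffian m (fun i j => (z j - z i) / (z j + z i)) =
      ∏ i, ∏ j ∈ Finset.Ioi i, (z j - z i) / (z j + z i) := by
  have h := pfaffian_mul_prod_eq_det (fun _ : ℂ => (1 : ℂ)) (fun z => z) (fun z => z ^ 2)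
    (fun s t => t + s) (fun s t => t - s) (fun s t => add_comm t s)
    (fun s t => s + t ≠ 0 ∧ s ≠ t) (fun s t _ => by ring)
    (fun s t h => ⟨by rw [add_comm]; exact h.1, sub_ne_zero.mpr h.2.symm⟩) (by
      intro m hm s p _ hp c hc
      have h1 := eval_eq_sum_lagrange (fun i => - p i) (fun i j hij => by
        by_contra hne
        exact (hp i j hne).2 (neg_injective hij)) ((X : ℂ[X]) ^ (2 * c))
        (by rw [natDegree_X_pow]; omega) s
      simp only [eval_pow, eval_X, pow_mul, neg_sq] at h1
      rw [h1]
      refine Finset.sum_congr rfl fun l _ => ?_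
      rw [mul_comm]
      congr 1
      refine Finset.prod_congr rfl fun k _ => ?_
      congr 1 <;> ring) m hm z hz
  have h2 : pairPowMatrix ((fun _ : ℂ => (1 : ℂ)) ∘ z) ((fun z => z) ∘ z) ((fun z => z ^ 2) ∘ z) =
      Matrix.vandermonde z := by
    ext i j
    simp only [pairPowMatrix, Matrix.of_apply, Matrix.vandermonde_apply, Function.comp, ← pow_mul]
    split_ifs with h
    · rw [one_mul]; congr 1; omega
    · rw [← pow_succ']; congr 1; omega
  rw [h2, Matrix.det_vandermonde] at h
  have h3 : (∏ i, ∏ j ∈ Finset.Ioi i, (z j + z i)) ≠ 0 := by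
    refine Finset.prod_ne_zero_iff.mpr fun i _ => Finset.prod_ne_zero_iff.mpr fun j hj => ?_
    rw [add_comm]
    exact (hz i j (Finset.mem_Ioi.mp hj).ne).1
  simp only [Finset.prod_div_distrib]
  rw [eq_div_iff h3, ← h]
  simp

/-- Schur's Pfaffian identity. -/
theorem schur_pfaffian {m : ℕ} (hm : Even m) (z : Fin m → ℂ)
    (hz : ∀ i j, i ≠ j → z j + z i ≠ 0) :
    pfaffian m (fun i j => (z j - z i) / (z j + z i)) =
      ∏ i, ∏ j ∈ Finset.Ioi i, (z j - z i) / (z j + z i) := by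
  obtain ⟨p, hp0, hp⟩ := exists_poly_general_position z
  have hcont : ∀ i j : Fin m, i < j → ContinuousAt (fun e : ℂ =>
      ((z j + e * ((j : ℕ) + 1)) - (z i + e * ((i : ℕ) + 1))) /
        ((z j + e * ((j : ℕ) + 1)) + (z i + e * ((i : ℕ) + 1)))) 0 := by
    intro i j hij
    refine ContinuousAt.div (by fun_prop) (by fun_prop) ?_
    simpa using hz i j hij.ne
  have h := eq_at_zero_of_eq_off_roots
    (f := fun e => pfaffian m (fun i j => ((z j + e * ((j : ℕ) + 1)) - (z i + e * ((i : ℕ) + 1))) /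
        ((z j + e * ((j : ℕ) + 1)) + (z i + e * ((i : ℕ) + 1)))))
    (g := fun e => ∏ i, ∏ j ∈ Finset.Ioi i, ((z j + e * ((j : ℕ) + 1)) - (z i + e * ((i : ℕ) + 1))) /
        ((z j + e * ((j : ℕ) + 1)) + (z i + e * ((i : ℕ) + 1))))
    (continuousAt_pfaffian m hcont)
    (tendsto_finsetProd _ fun i _ => tendsto_finsetProd _ fun j hj =>
      hcont i j (Finset.mem_Ioi.mp hj)) hp0
    (fun e he => schur_pfaffian_of_general_position hm _ fun i j hij =>
      ⟨((hp e he).2 i j hij).2.1, ((hp e he).2 i j hij).1⟩)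
  simpa using h

/-- The Pfaffian of `(a_i b_j - b_i a_j) / (s_i s_j - 1 / (s_i s_j))` as a single determinant in
powers of `(s_i + 1 / s_i) ^ 2`. -/
theorem pfaffian_inv_pairs {m : ℕ} (hm : Even m) (a b : ℂ → ℂ) (s : Fin m → ℂ)
    (hs : ∀ i, s i ≠ 0)
    (hs2 : ∀ i j, i ≠ j → s i ^ 2 * s j ^ 2 ≠ 1 ∧ s i ^ 2 ≠ s j ^ 2) :
    pfaffian m (fun i j => (a (s i) * b (s j) - b (s i) * a (s j)) /
        (s i * s j - (s i * s j)⁻¹)) *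
      (∏ i, ∏ j ∈ Finset.Ioi i, (s i * s j - (s i * s j)⁻¹)) =
    (pairPowMatrix (fun i => a (s i)) (fun i => b (s i)) (fun i => (s i + (s i)⁻¹) ^ 2)).det := by
  refine pfaffian_mul_prod_eq_det a b (fun s => (s + s⁻¹) ^ 2)
    (fun s t => s * t - (s * t)⁻¹) (fun s t => t / s - s / t) (fun s t => by rw [mul_comm s t])
    (fun s t => s ≠ 0 ∧ t ≠ 0 ∧ s ^ 2 * t ^ 2 ≠ 1 ∧ s ^ 2 ≠ t ^ 2) ?_ ?_ ?_ m hm s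
    (fun i j hij => ⟨hs i, hs j, hs2 i j hij⟩)
  · rintro s t ⟨h1, h2, -, -⟩
    field_simp
    ring
  · rintro s t ⟨h1, h2, h3, h4⟩
    have e1 : s * t - (s * t)⁻¹ = (s ^ 2 * t ^ 2 - 1) / (s * t) := by field_simp
    have e2 : t / s - s / t = (t ^ 2 - s ^ 2) / (s * t) := by field_simp
    exact ⟨by rw [e1]; exact div_ne_zero (sub_ne_zero.mpr h3) (mul_ne_zero h1 h2),
      by rw [e2]; exact div_ne_zero (sub_ne_zero.mpr h4.symm) (mul_ne_zero h1 h2)⟩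
  · intro m hm s p hsp hp c hc
    have hs0 := (hsp 0).1
    have hp0 : ∀ i, p i ≠ 0 := fun i => (hsp i).2.1
    obtain ⟨r, rfl⟩ := hm
    -- `(t + 1 / t + 2) ^ c` times `t ^ r` is a polynomial in `t = s ^ 2`, and `t ↦ 1 / t` fixes it
    -- up to the power of `t`; hence the nodes `1 / p_l ^ 2`.
    have h1 := eval_eq_sum_lagrange (fun i => (p i ^ 2)⁻¹) (fun i j hij => by
      by_contra hne
      exact (hp i j hne).2.2.2 (inv_injective hij)) (((X : ℂ[X]) + C 1) ^ (2 * c) * X ^ (r - c))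
      (by
        refine (natDegree_mul_le).trans ?_
        rw [natDegree_X_pow, natDegree_pow, natDegree_X_add_C]
        omega) (s ^ 2)
    have hP : ∀ t : ℂ, t ≠ 0 → (((X : ℂ[X]) + C 1) ^ (2 * c) * X ^ (r - c)).eval (t ^ 2) =
        t ^ (2 * r) * ((t + t⁻¹) ^ 2) ^ c := by
      intro t ht
      simp only [eval_mul, eval_pow, eval_add, eval_X, eval_C]
      have e1 : t + t⁻¹ = (t ^ 2 + 1) / t := by field_simp
      have e2 : t ^ (2 * r) = (t ^ 2) ^ (r - c) * (t ^ 2) ^ c := by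
        rw [← pow_add, ← pow_mul]; congr 1; omega
      rw [e1, e2, div_pow, div_pow, mul_comm, ← pow_mul, pow_mul _ 2 c]
      field_simp
    rw [hP s hs0] at h1
    have hinv : ∀ t : ℂ, (t ^ 2)⁻¹ = t⁻¹ ^ 2 := fun t => by rw [inv_pow]
    have h2 : s ^ (2 * r) * ((s + s⁻¹) ^ 2) ^ c = s ^ (2 * r) * ∑ l,
        (∏ k : Fin (r + r), (s * p (l.succAbove k) - (s * p (l.succAbove k))⁻¹) /
          (p (l.succAbove k) / p l - p l / p (l.succAbove k))) * ((p l + (p l)⁻¹) ^ 2) ^ c := by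
      rw [h1, Finset.mul_sum]
      refine Finset.sum_congr rfl fun l _ => ?_
      have e1 : ∀ k : Fin (r + r), (s ^ 2 - (p (l.succAbove k) ^ 2)⁻¹) /
          ((p l ^ 2)⁻¹ - (p (l.succAbove k) ^ 2)⁻¹) = (s * p l) *
          ((s * p (l.succAbove k) - (s * p (l.succAbove k))⁻¹) /
          (p (l.succAbove k) / p l - p l / p (l.succAbove k))) := by
        intro k
        have a1 := hp0 l
        have a2 := hp0 (l.succAbove k)
        have a3 := (hp l (l.succAbove k) (Fin.succAbove_ne l k).symm).2.2.2
        have a4 : p (l.succAbove k) ^ 2 - p l ^ 2 ≠ 0 := sub_ne_zero.mpr a3.symm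
        have d1 : (p l ^ 2)⁻¹ - (p (l.succAbove k) ^ 2)⁻¹ =
          (p (l.succAbove k) ^ 2 - p l ^ 2) / (p l ^ 2 * p (l.succAbove k) ^ 2) := by field_simp
        have d2 : p (l.succAbove k) / p l - p l / p (l.succAbove k) =
          (p (l.succAbove k) ^ 2 - p l ^ 2) / (p l * p (l.succAbove k)) := by field_simp
        rw [d1, d2]
        field_simp
      simp only [e1]
      rw [Finset.prod_mul_distrib, Finset.prod_const, Finset.card_univ, Fintype.card_fin, hinv,
        hP _ (inv_ne_zero (hp0 l)), inv_inv, mul_pow, inv_pow, add_comm (p l)⁻¹]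
      have a1 : p l ^ (2 * r) ≠ 0 := pow_ne_zero _ (hp0 l)
      have a2 : ∀ x : ℂ, x ^ (r + r) = x ^ (2 * r) := fun x => by rw [two_mul]
      simp only [a2]
      field_simp
    exact mul_left_cancel₀ (pow_ne_zero _ hs0) h2

/-! ### Ratios of `q`-shifted factorials and the polynomials `c_k` -/

/-- The ratio `(-q; q)_k / (q; q)_k` for `k ≥ 0`, extended by `0` to negative `k`. With this
extension `w_{k-1} (1 + q^k) = w_k (1 - q^k)` holds also at `k = 0`. -/
noncomputable def qRatio (q : ℂ) (k : ℤ) : ℂ :=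
  if 0 ≤ k then qPoch (-q) q k.toNat / qPoch q q k.toNat else 0

/-- The self-reciprocal polynomial function `∑_k w_k w_{N-k} t^k`, where `w = qRatio q`. -/
noncomputable def genF (q : ℂ) (N : ℕ) (t : ℂ) : ℂ :=
  ∑ k ∈ Finset.range (N + 1), qRatio q k * qRatio q (N - k) * t ^ k

/-- The coefficient `γ_k` in the recurrence `c_{k+1} = x c_k - γ_k c_{k-1}`. -/
noncomputable def recCoeff (q : ℂ) (k : ℕ) : ℂ :=
  (1 - q ^ k) * (1 - q ^ (k + 1)) / ((1 + q ^ k) * (1 + q ^ (k + 1)))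

theorem qRatio_natCast (q : ℂ) (k : ℕ) : qRatio q k = qPoch (-q) q k / qPoch q q k := by
  simp [qRatio]

theorem qRatio_of_neg (q : ℂ) {k : ℤ} (hk : k < 0) : qRatio q k = 0 := by
  simp [qRatio, hk.not_ge]

theorem qRatio_zero (q : ℂ) : qRatio q 0 = 1 := by simp [qRatio, qPoch]

section

variable {q : ℂ} (hq : ∀ k : ℕ, 1 ≤ k → q ^ k ≠ 1)

include hq

theorem one_sub_pow_ne_zero {k : ℕ} (hk : 1 ≤ k) : 1 - q ^ k ≠ 0 :=
  sub_ne_zero.mpr (hq k hk).symm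

theorem one_add_pow_ne_zero (k : ℕ) : 1 + q ^ k ≠ 0 := by
  intro h
  rcases Nat.eq_zero_or_pos k with rfl | hk
  · norm_num at h
  · refine hq (k * 2) (by omega) ?_
    rw [pow_mul]
    linear_combination (q ^ k - 1) * h

theorem pow_add_pow_ne_zero (hq0 : q ≠ 0) (k l : ℕ) : q ^ k + q ^ l ≠ 0 := by
  rcases le_total k l with h | h
  · obtain ⟨d, rfl⟩ := Nat.exists_eq_add_of_le h
    rw [pow_add, show q ^ k + q ^ k * q ^ d = q ^ k * (1 + q ^ d) by ring]
    exact mul_ne_zero (pow_ne_zero _ hq0) (one_add_pow_ne_zero hq d)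
  · obtain ⟨d, rfl⟩ := Nat.exists_eq_add_of_le h
    rw [pow_add, show q ^ l * q ^ d + q ^ l = q ^ l * (1 + q ^ d) by ring]
    exact mul_ne_zero (pow_ne_zero _ hq0) (one_add_pow_ne_zero hq d)

theorem qPoch_self_ne_zero (k : ℕ) : qPoch q q k ≠ 0 := by
  refine Finset.prod_ne_zero_iff.mpr fun i _ => ?_
  rw [← pow_succ']
  exact one_sub_pow_ne_zero hq (by omega)

theorem qPoch_neg_ne_zero (k : ℕ) : qPoch (-q) q k ≠ 0 := by
  refine Finset.prod_ne_zero_iff.mpr fun i _ => ?_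
  have h := one_add_pow_ne_zero hq (i + 1)
  rwa [pow_succ', show 1 + q * q ^ i = 1 - -q * q ^ i by ring] at h

theorem qRatio_ne_zero (k : ℕ) : qRatio q k ≠ 0 := by
  rw [qRatio_natCast]
  exact div_ne_zero (qPoch_neg_ne_zero hq k) (qPoch_self_ne_zero hq k)

theorem qRatio_succ (k : ℕ) :
    qRatio q (k + 1 : ℕ) = qRatio q k * ((1 + q ^ (k + 1)) / (1 - q ^ (k + 1))) := by
  rw [qRatio_natCast, qRatio_natCast, qPoch, qPoch, Finset.prod_range_succ, Finset.prod_range_succ,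
    ← qPoch, ← qPoch]
  have h1 := qPoch_self_ne_zero hq k
  have h2 := one_sub_pow_ne_zero hq (k := k + 1) (by omega)
  have h3 : 1 - q * q ^ k = 1 - q ^ (k + 1) := by ring
  have h4 : 1 - -q * q ^ k = 1 + q ^ (k + 1) := by ring
  rw [h3, h4]
  field_simp

/-- Consecutive ratios are proportional to `(1 - q^k, 1 + q^k)`. -/
theorem exists_qRatio_pair (k : ℕ) :
    ∃ ρ, qRatio q (k - 1) = ρ * (1 - q ^ k) ∧ qRatio q k = ρ * (1 + q ^ k) := by
  have h := one_add_pow_ne_zero hq k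
  refine ⟨qRatio q k / (1 + q ^ k), ?_, by field_simp⟩
  rcases k with _ | k
  · rw [qRatio_of_neg q (by simp)]; simp
  · have h2 := one_sub_pow_ne_zero hq (k := k + 1) (by omega)
    rw [qRatio_succ hq, show ((k + 1 : ℕ) : ℤ) - 1 = k by push_cast; ring]
    field_simp

end

theorem genF_eq_sum_range (q : ℂ) {N M : ℕ} (h : N + 1 ≤ M) (t : ℂ) :
    genF q N t = ∑ k ∈ Finset.range M, qRatio q k * qRatio q (N - k) * t ^ k := by
  rw [genF]
  refine Finset.sum_subset (Finset.range_subset_range.mpr h) fun k _ hk => ?_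
  rw [Finset.mem_range] at hk
  rw [qRatio_of_neg q (k := N - k) (by omega)]
  simp

theorem mul_genF_eq_sum_range (q : ℂ) {N M : ℕ} (h : N + 2 ≤ M) (t : ℂ) :
    t * genF q N t =
      ∑ k ∈ Finset.range M, qRatio q (k - 1) * qRatio q (N + 1 - k) * t ^ k := by
  obtain ⟨M, rfl⟩ : ∃ M', M = M' + 1 := ⟨M - 1, by omega⟩
  rw [Finset.sum_range_succ', genF_eq_sum_range q (show N + 1 ≤ M by omega), Finset.mul_sum,
    qRatio_of_neg q (k := ((0 : ℕ) : ℤ) - 1) (by simp)]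
  simp only [zero_mul, add_zero]
  refine Finset.sum_congr rfl fun k _ => ?_
  rw [show (((k + 1 : ℕ) : ℤ) - 1) = k by push_cast; ring,
    show ((N : ℤ) + 1 - (k + 1 : ℕ)) = N - k by push_cast; ring]
  ring

theorem genF_recurrence {q : ℂ} (hq : ∀ k : ℕ, 1 ≤ k → q ^ k ≠ 1) (N : ℕ) (t : ℂ) :
    (t + 1) * genF q (N + 1) t =
      (1 - q ^ (N + 2)) / (1 + q ^ (N + 2)) * (genF q (N + 2) t + t * genF q N t) := by
  rw [add_mul, one_mul, mul_genF_eq_sum_range q (show (N + 1) + 2 ≤ N + 3 by omega),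
    genF_eq_sum_range q (show (N + 1) + 1 ≤ N + 3 by omega),
    mul_genF_eq_sum_range q (show N + 2 ≤ N + 3 by omega),
    genF_eq_sum_range q (show (N + 2) + 1 ≤ N + 3 by omega), ← Finset.sum_add_distrib,
    ← Finset.sum_add_distrib, Finset.mul_sum]
  refine Finset.sum_congr rfl fun i hi => ?_
  obtain ⟨j, hj⟩ : ∃ j, N + 2 = i + j := Nat.exists_eq_add_of_le (by simp at hi; omega)
  obtain ⟨ρ, h1, h2⟩ := exists_qRatio_pair hq i
  obtain ⟨σ, h3, h4⟩ := exists_qRatio_pair hq j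
  have hQ := one_add_pow_ne_zero hq (N + 2)
  rw [hj, pow_add] at hQ ⊢
  rw [show (((N + 1 : ℕ) : ℤ) + 1 - i) = j by omega, show (((N + 1 : ℕ) : ℤ) - i) = j - 1 by omega,
    show (((i + j : ℕ) : ℤ) - i) = j by omega, show ((N : ℤ) + 1 - i) = j - 1 by omega,
    h1, h2, h3, h4]
  field_simp
  ring

/-- The two-variable case: a Christoffel–Darboux type formula, checked on coefficients. -/
theorem sum_pair_eq {q : ℂ} (hq0 : q ≠ 0) (hq : ∀ k : ℕ, 1 ≤ k → q ^ k ≠ 1) (N : ℕ) (t u : ℂ) :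
    (t * u - 1) * ∑ a : Fin (N + 2), ∑ b : Fin (N + 2),
        (q ^ (b : ℕ) - q ^ (a : ℕ)) / (q ^ (b : ℕ) + q ^ (a : ℕ)) *
          (qRatio q (a : ℕ) * qRatio q ((N + 1 : ℕ) - (a : ℕ)) * t ^ (a : ℕ)) *
          (qRatio q (b : ℕ) * qRatio q ((N + 1 : ℕ) - (b : ℕ)) * u ^ (b : ℕ)) =
      -((1 - q ^ (N + 2)) / (1 + q ^ (N + 2))) *
        ((t * genF q N t) * genF q (N + 2) u - genF q (N + 2) t * (u * genF q N u)) := by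
  let S : ℕ → ℕ → ℂ := fun a b => (q ^ b - q ^ a) / (q ^ b + q ^ a)
  have hS : ∀ a b, S (a + 1) (b + 1) = S a b := by
    intro a b
    have h1 := pow_add_pow_ne_zero hq hq0 b a
    have h2 := pow_add_pow_ne_zero hq hq0 (b + 1) (a + 1)
    simp only [S]
    rw [div_eq_div_iff h2 h1]
    ring
  have hsum : ∀ g : ℕ → ℕ → ℂ, ∑ a : Fin (N + 2), ∑ b : Fin (N + 2), g a b =
      ∑ a ∈ Finset.range (N + 2), ∑ b ∈ Finset.range (N + 2), g a b := by
    intro g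
    rw [← Fin.sum_univ_eq_sum_range (fun a => ∑ b ∈ Finset.range (N + 2), g a b)]
    refine Finset.sum_congr rfl fun a _ => ?_
    rw [← Fin.sum_univ_eq_sum_range (fun b => g a b)]
  have hneg : qRatio q ((N + 1 : ℕ) - (N + 2 : ℕ)) = 0 := qRatio_of_neg q (by omega)
  have hA : ∑ a ∈ Finset.range (N + 2), ∑ b ∈ Finset.range (N + 2), S a b *
        (qRatio q a * qRatio q ((N + 1 : ℕ) - a) * t ^ a) *
        (qRatio q b * qRatio q ((N + 1 : ℕ) - b) * u ^ b) =
      ∑ a ∈ Finset.range (N + 3), ∑ b ∈ Finset.range (N + 3), S a b *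
        (qRatio q a * qRatio q ((N + 1 : ℕ) - a) * t ^ a) *
        (qRatio q b * qRatio q ((N + 1 : ℕ) - b) * u ^ b) := by
    rw [Finset.sum_range_succ _ (N + 2)]
    simp only [Finset.sum_range_succ _ (N + 2), hneg]
    simp
  have hB : t * u * ∑ a ∈ Finset.range (N + 2), ∑ b ∈ Finset.range (N + 2), S a b *
        (qRatio q a * qRatio q ((N + 1 : ℕ) - a) * t ^ a) *
        (qRatio q b * qRatio q ((N + 1 : ℕ) - b) * u ^ b) =
      ∑ a ∈ Finset.range (N + 3), ∑ b ∈ Finset.range (N + 3), S a b *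
        (qRatio q (a - 1) * qRatio q ((N + 2 : ℕ) - a) * t ^ a) *
        (qRatio q (b - 1) * qRatio q ((N + 2 : ℕ) - b) * u ^ b) := by
    have hz : qRatio q (((0 : ℕ) : ℤ) - 1) = 0 := qRatio_of_neg q (by simp)
    rw [Finset.sum_range_succ' _ (N + 2)]
    simp only [Finset.sum_range_succ' _ (N + 2), hz]
    simp only [zero_mul, mul_zero, add_zero, Finset.sum_const_zero, Finset.mul_sum]
    refine Finset.sum_congr rfl fun a _ => Finset.sum_congr rfl fun b _ => ?_
    rw [hS, show (((a + 1 : ℕ) : ℤ) - 1) = a by omega, show (((b + 1 : ℕ) : ℤ) - 1) = b by omega,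
      show (((N + 2 : ℕ) : ℤ) - (a + 1 : ℕ)) = (N + 1 : ℕ) - a by omega,
      show (((N + 2 : ℕ) : ℤ) - (b + 1 : ℕ)) = (N + 1 : ℕ) - b by omega]
    ring
  rw [hsum fun a b => S a b * (qRatio q a * qRatio q ((N + 1 : ℕ) - a) * t ^ a) *
        (qRatio q b * qRatio q ((N + 1 : ℕ) - b) * u ^ b), sub_mul, one_mul, hB, hA,
    mul_genF_eq_sum_range q (show N + 2 ≤ N + 3 by omega),
    mul_genF_eq_sum_range q (show N + 2 ≤ N + 3 by omega),
    genF_eq_sum_range q (show (N + 2) + 1 ≤ N + 3 by omega),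
    genF_eq_sum_range q (show (N + 2) + 1 ≤ N + 3 by omega), Finset.sum_mul_sum,
    Finset.sum_mul_sum, ← Finset.sum_sub_distrib, ← Finset.sum_sub_distrib, Finset.mul_sum]
  refine Finset.sum_congr rfl fun a ha => ?_
  rw [← Finset.sum_sub_distrib, ← Finset.sum_sub_distrib, Finset.mul_sum]
  refine Finset.sum_congr rfl fun b hb => ?_
  -- With `(w_{k-1}, w_k)` proportional to `(1 - q^k, 1 + q^k)` for `k = a`, `b` and for their
  -- complements `N + 2 - a`, `N + 2 - b`, a rational identity in `q^a`, `q^b`, `q^(N+2)` remains.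
  obtain ⟨a', ha'⟩ : ∃ j, N + 2 = a + j := Nat.exists_eq_add_of_le (by simp at ha; omega)
  obtain ⟨b', hb'⟩ : ∃ j, N + 2 = b + j := Nat.exists_eq_add_of_le (by simp at hb; omega)
  obtain ⟨ρ, h1, h2⟩ := exists_qRatio_pair hq a
  obtain ⟨ρ', h1', h2'⟩ := exists_qRatio_pair hq a'
  obtain ⟨σ, h3, h4⟩ := exists_qRatio_pair hq b
  obtain ⟨σ', h3', h4'⟩ := exists_qRatio_pair hq b'
  rw [show (((N + 2 : ℕ) : ℤ) - a) = a' by omega, show (((N + 2 : ℕ) : ℤ) - b) = b' by omega,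
    show (((N + 1 : ℕ) : ℤ) - a) = a' - 1 by omega, show (((N + 1 : ℕ) : ℤ) - b) = b' - 1 by omega,
    show ((N : ℤ) + 1 - a) = a' - 1 by omega, show ((N : ℤ) + 1 - b) = b' - 1 by omega,
    h1, h2, h1', h2', h3, h4, h3', h4']
  have hQ := one_add_pow_ne_zero hq (N + 2)
  have hab := pow_add_pow_ne_zero hq hq0 b a
  have eX : q ^ a' = q ^ (N + 2) / q ^ a := by
    rw [eq_div_iff (pow_ne_zero _ hq0), ha', pow_add]; ring
  have eY : q ^ b' = q ^ (N + 2) / q ^ b := by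
    rw [eq_div_iff (pow_ne_zero _ hq0), hb', pow_add]; ring
  simp only [S]
  rw [eX, eY]
  have hX : q ^ a ≠ 0 := pow_ne_zero _ hq0
  have hY : q ^ b ≠ 0 := pow_ne_zero _ hq0
  generalize q ^ (N + 2) = Q at *
  generalize q ^ a = X at *
  generalize q ^ b = Y at *
  field_simp
  ring

theorem chebyshevT_eval_add_inv (s : ℂ) (hs : s ≠ 0) (l : ℤ) :
    (Chebyshev.T ℂ l).eval ((s + s⁻¹) / 2) = (s ^ l + (s ^ l)⁻¹) / 2 := by
  have h := Chebyshev.T_complex_cosh (Complex.log s) l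
  rwa [Complex.cosh, Complex.exp_neg, Complex.exp_log hs, Complex.cosh, Complex.exp_neg,
    Complex.exp_int_mul, Complex.exp_log hs] at h

theorem pow_mul_monicC_eval (q : ℂ) (N : ℕ) (s : ℂ) (hs : s ≠ 0) :
    s ^ N * (monicC q N).eval (s + s⁻¹) = genF q N (s ^ 2) / qRatio q N := by
  have h1 : s ^ N * (qUltraspherical (-q) q N).eval ((s + s⁻¹) / 2) =
      ∑ k ∈ Finset.range (N + 1), qRatio q k * qRatio q (N - k) *
        ((s ^ 2) ^ (N - k) + (s ^ 2) ^ k) / 2 := by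
    rw [qUltraspherical, eval_finsetSum, Finset.mul_sum]
    refine Finset.sum_congr rfl fun k hk => ?_
    have hkN : k ≤ N := by simp at hk; omega
    rw [eval_mul, eval_C, chebyshevT_eval_add_inv s hs, ← Int.natCast_sub hkN, qRatio_natCast,
      qRatio_natCast]
    have e1 : s ^ N * s ^ ((N : ℤ) - 2 * k) = (s ^ 2) ^ (N - k) := by
      rw [← zpow_natCast, ← zpow_add₀ hs, ← pow_mul, ← zpow_natCast]
      congr 1; push_cast [hkN]; ring
    have e2 : s ^ N * (s ^ ((N : ℤ) - 2 * k))⁻¹ = (s ^ 2) ^ k := by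
      rw [← zpow_neg, ← zpow_natCast, ← zpow_add₀ hs, ← pow_mul, ← zpow_natCast]
      congr 1; push_cast; ring
    rw [← e1, ← e2, mul_div_mul_comm]
    ring
  have h2 : ∑ k ∈ Finset.range (N + 1), qRatio q k * qRatio q (N - k) * (s ^ 2) ^ (N - k) =
      genF q N (s ^ 2) := by
    rw [genF, ← Finset.sum_range_reflect]
    refine Finset.sum_congr rfl fun k hk => ?_
    have hkN : k ≤ N := by simp at hk; omega
    rw [show N + 1 - 1 - k = N - k by omega, Nat.cast_sub hkN, Nat.sub_sub_self hkN]
    rw [show (N : ℤ) - (N - k) = k by ring]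
    ring
  have h3 : s ^ N * (qUltraspherical (-q) q N).eval ((s + s⁻¹) / 2) = genF q N (s ^ 2) := by
    rw [h1]
    simp only [mul_add, add_div, Finset.sum_add_distrib]
    rw [← Finset.sum_div, ← Finset.sum_div, h2, ← genF]
    ring
  rw [monicC, eval_mul, eval_C, eval_comp, eval_mul, eval_C, eval_X,
    show 1 / 2 * (s + s⁻¹) = (s + s⁻¹) / 2 by ring, ← h3, qRatio_natCast, div_div_eq_mul_div]
  ring

theorem exists_add_inv_eq (x : ℂ) : ∃ s : ℂ, s ≠ 0 ∧ s + s⁻¹ = x := by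
  obtain ⟨r, hr⟩ := IsAlgClosed.exists_pow_nat_eq (x ^ 2 / 4 - 1) (n := 2) (by norm_num)
  have h : (x / 2 + r) * (x / 2 - r) = 1 := by linear_combination -hr
  refine ⟨x / 2 + r, left_ne_zero_of_mul_eq_one h, ?_⟩
  rw [inv_eq_of_mul_eq_one_right h]
  ring

theorem monicC_zero (q : ℂ) : monicC q 0 = 1 := by
  simp [monicC, qUltraspherical, qPoch]

section

variable {q : ℂ} (hq : ∀ k : ℕ, 1 ≤ k → q ^ k ≠ 1)

include hq

theorem monicC_one : monicC q 1 = X := by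
  refine Polynomial.funext fun x => ?_
  obtain ⟨s, hs, rfl⟩ := exists_add_inv_eq x
  have h := pow_mul_monicC_eval q 1 s hs
  have h1 := qRatio_ne_zero hq 1
  have h2 : genF q 1 (s ^ 2) = qRatio q (1 : ℕ) * (1 + s ^ 2) := by
    rw [genF, Finset.sum_range_succ, Finset.sum_range_one]
    simp [qRatio_zero]
    ring
  rw [h2, mul_div_cancel_left₀ _ h1, pow_one] at h
  rw [eval_X]
  refine mul_left_cancel₀ hs ?_
  rw [h]
  field_simp
  ring

theorem monicC_add_two (k : ℕ) :
    monicC q (k + 2) = X * monicC q (k + 1) - C (recCoeff q (k + 1)) * monicC q k := by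
  refine Polynomial.funext fun x => ?_
  obtain ⟨s, hs, rfl⟩ := exists_add_inv_eq x
  have h0 := pow_mul_monicC_eval q k s hs
  have h1 := pow_mul_monicC_eval q (k + 1) s hs
  have h2 := pow_mul_monicC_eval q (k + 2) s hs
  have hr := genF_recurrence hq k (s ^ 2)
  have hw := qRatio_ne_zero hq k
  have a1 := one_sub_pow_ne_zero hq (k := k + 1) (by omega)
  have a2 := one_sub_pow_ne_zero hq (k := k + 2) (by omega)
  have b1 := one_add_pow_ne_zero hq (k + 1)
  have b2 := one_add_pow_ne_zero hq (k + 2)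
  rw [qRatio_succ hq k] at h1
  have e2 : qRatio q (k + 2 : ℕ) = qRatio q (k + 1 : ℕ) * ((1 + q ^ (k + 2)) / (1 - q ^ (k + 2))) :=
    qRatio_succ hq (k + 1)
  rw [e2, qRatio_succ hq k] at h2
  simp only [eval_sub, eval_mul, eval_X, eval_C]
  refine mul_left_cancel₀ (pow_ne_zero (k + 2) hs) ?_
  rw [show s ^ (k + 2) * ((s + s⁻¹) * (monicC q (k + 1)).eval (s + s⁻¹) -
      recCoeff q (k + 1) * (monicC q k).eval (s + s⁻¹)) =
      (s ^ 2 + 1) * (s ^ (k + 1) * (monicC q (k + 1)).eval (s + s⁻¹)) -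
      recCoeff q (k + 1) * s ^ 2 * (s ^ k * (monicC q k).eval (s + s⁻¹)) by field_simp; ring,
    h0, h1, h2, recCoeff, ← mul_div_assoc (s ^ 2 + 1), hr, show k + 1 + 1 = k + 2 from rfl]
  field_simp
  ring

theorem natDegree_monicC : ∀ k, (monicC q k).natDegree = k ∧ (monicC q k).Monic
  | 0 => by simp [monicC_zero]
  | 1 => by simp [monicC_one hq]
  | k + 2 => by
    have h1 := natDegree_monicC (k + 1)
    have h0 := natDegree_monicC k
    have hm : (X * monicC q (k + 1)).Monic := monic_X.mul h1.2
    have hd : (X * monicC q (k + 1)).natDegree = k + 2 := by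
      rw [monic_X.natDegree_mul h1.2, natDegree_X, h1.1]; ring
    have hlt : (C (recCoeff q (k + 1)) * monicC q k).degree < (X * monicC q (k + 1)).degree := by
      refine degree_lt_degree ?_
      rw [hd]
      exact lt_of_le_of_lt ((natDegree_C_mul_le _ _).trans h0.1.le) (by omega)
    rw [monicC_add_two hq]
    exact ⟨by rw [natDegree_sub_eq_left_of_natDegree_lt
      (by rw [hd]; exact lt_of_le_of_lt ((natDegree_C_mul_le _ _).trans h0.1.le) (by omega)), hd], hm.sub_of_left hlt⟩

end

/-! ### Column operations on determinants -/

theorem det_eq_of_triangular {K V : Type*} [Field K] [AddCommGroup V] [Module K V] {m : ℕ}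
    (ev : Fin m → V →ₗ[K] K) (d e : ℕ → V) (μ : ℕ → K)
    (h : ∀ j < m, d j - μ j • e j ∈ Submodule.span K (e '' (Finset.range j : Set ℕ))) :
    (Matrix.of fun i j : Fin m => ev i (d j)).det =
      (∏ j ∈ Finset.range m, μ j) * (Matrix.of fun i j : Fin m => ev i (e j)).det := by
  have h' : ∀ j : Fin m, ∃ c : ℕ → K, ∑ i ∈ Finset.range j, c i • e i = d j - μ j • e j :=
    fun j => (Submodule.mem_span_image_finset_iff_exists_fun' K).mp (h j j.2)
  choose c hc using h'
  let U : Matrix (Fin m) (Fin m) K := Matrix.of fun i j =>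
    if i < j then c j i else if i = j then μ j else 0
  have hU : U.det = ∏ j ∈ Finset.range m, μ j := by
    rw [Matrix.det_of_isUpperTriangular]
    · rw [← Fin.prod_univ_eq_prod_range]; simp [U]
    · intro i j hij
      have h1 : j < i := hij
      simp only [U, Matrix.of_apply]
      rw [if_neg h1.not_gt, if_neg h1.ne']
  rw [← hU, mul_comm, ← Matrix.det_mul]
  congr 1
  ext i j
  have hd : d j = ∑ k ∈ Finset.range j, c j k • e k + μ j • e j := by rw [hc]; abel
  have hsum : ∑ k ∈ Finset.range j, c j k * ev i (e k) =
      ∑ k : Fin m, if k < j then c j k * ev i (e k) else 0 := by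
    have h1 := Finset.sum_range (n := m) fun k => if k < (j : ℕ) then c j k * ev i (e k) else 0
    simp only [Fin.val_fin_lt] at h1
    rw [← h1, ← Finset.sum_filter]
    congr 1
    ext k
    simp only [Finset.mem_range, Finset.mem_filter]
    exact ⟨fun hk => ⟨hk.trans j.2, hk⟩, fun hk => hk.2⟩
  rw [Matrix.of_apply, hd, map_add, map_sum, Matrix.mul_apply]
  simp only [map_smul, smul_eq_mul]
  rw [hsum]
  have : ∀ k : Fin m, (Matrix.of fun i j : Fin m => ev i (e j)) i k * U k j =
      (if k < j then c j k * ev i (e k) else 0) + if k = j then μ j * ev i (e j) else 0 := by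
    intro k
    simp only [U, Matrix.of_apply]
    rcases lt_trichotomy k j with h | h | h
    · simp [h, h.ne, mul_comm]
    · simp [h, mul_comm]
    · simp [h.not_gt, h.ne']
  simp only [this, Finset.sum_add_distrib]
  simp

/-- If multiplication by `y` sends `e_j` to a multiple of `e_{j+2}` plus earlier terms, then the
powers `y ^ i e_0`, `y ^ i e_1` are triangular in the sequence `e`. -/
theorem sub_mem_span_of_two_step {K A : Type*} [Field K] [CommRing A] [Algebra K A] {m : ℕ} (y : A)
    (d e : ℕ → A) (μ lam : ℕ → K) (hμ0 : μ 0 = 1) (hμ1 : μ 1 = 1)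
    (hμ : ∀ j, j + 2 < m → μ (j + 2) = μ j * lam j)
    (hd0 : d 0 = e 0) (hd1 : d 1 = e 1) (hd : ∀ j, d (j + 2) = y * d j)
    (he : ∀ j, j + 2 < m → y * e j - lam j • e (j + 2) ∈
      Submodule.span K (e '' (Finset.range (j + 2) : Set ℕ))) :
    ∀ j < m, d j - μ j • e j ∈ Submodule.span K (e '' (Finset.range j : Set ℕ))
  | 0, _ => by simp [hd0, hμ0]
  | 1, _ => by simp [hd1, hμ1]
  | j + 2, hj => by
    have ih := sub_mem_span_of_two_step y d e μ lam hμ0 hμ1 hμ hd0 hd1 hd he j (by omega)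
    have hmap : Submodule.span K (e '' (Finset.range j : Set ℕ)) ≤
        (Submodule.span K (e '' (Finset.range (j + 2) : Set ℕ))).comap (LinearMap.mulLeft K y) := by
      rw [Submodule.span_le]
      rintro _ ⟨i, hi, rfl⟩
      have hi' : i < j := by simpa using hi
      have h1 := he i (by omega)
      have h2 : Submodule.span K (e '' (Finset.range (i + 2) : Set ℕ)) ≤
          Submodule.span K (e '' (Finset.range (j + 2) : Set ℕ)) :=
        Submodule.span_mono (Set.image_mono (by
          exact_mod_cast Finset.range_subset_range.mpr (by omega)))
      have h3 : e (i + 2) ∈ Submodule.span K (e '' (Finset.range (j + 2) : Set ℕ)) :=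
        Submodule.subset_span ⟨i + 2, by simp; omega, rfl⟩
      have h4 := Submodule.add_mem _ (h2 h1) (Submodule.smul_mem _ (lam i) h3)
      simpa using h4
    have h1 := Submodule.mem_comap.mp (hmap ih)
    have h2 := Submodule.add_mem _ h1 (Submodule.smul_mem _ (μ j) (he j hj))
    have h3 : (LinearMap.mulLeft K y) (d j - μ j • e j) + μ j • (y * e j - lam j • e (j + 2)) =
        d (j + 2) - μ (j + 2) • e (j + 2) := by
      rw [hd, hμ j hj, LinearMap.mulLeft_apply, mul_sub, mul_smul_comm, smul_sub, smul_smul]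
      abel
    rwa [h3] at h2

/-- Ordering columns outwards from the centre, `-1, 0, -2, 1, -3, 2, …`, or increasingly gives the
same determinant: each new column `-(r+1)` has to pass `2 r` columns. -/
theorem det_outward_eq_det_sorted {R : Type*} [CommRing R] : ∀ (r : ℕ) (h : ℤ → Fin (2 * r) → R),
    (Matrix.of fun i j : Fin (2 * r) =>
      h (if (j : ℕ) % 2 = 0 then -((j : ℕ) / 2 : ℕ) - 1 else ((j : ℕ) / 2 : ℕ)) i).det =
    (Matrix.of fun i p : Fin (2 * r) => h ((p : ℕ) - r) i).det
  | 0, h => by simp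
  | r + 1, h => by
    change (Matrix.of fun i j : Fin (2 * r + 1 + 1) =>
      h (if (j : ℕ) % 2 = 0 then -((j : ℕ) / 2 : ℕ) - 1 else ((j : ℕ) / 2 : ℕ)) i).det =
      (Matrix.of fun i p : Fin (2 * r + 1 + 1) => h ((p : ℕ) - (r + 1 : ℕ)) i).det
    rw [Matrix.det_succ_column _ (Fin.last _), Matrix.det_succ_column _ (Fin.last _)]
    refine Finset.sum_congr rfl fun i _ => ?_
    congr 1
    · congr 1
      simp only [Matrix.of_apply, Fin.val_last]
      congr 1
      rw [if_neg (by omega)]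
      omega
    · rw [Matrix.det_succ_column _ (Fin.last _), Matrix.det_succ_column _ 0]
      refine Finset.sum_congr rfl fun k _ => ?_
      have ih := det_outward_eq_det_sorted r fun z l => h z (i.succAbove (k.succAbove l))
      congr 1
      · congr 1
        · simp [pow_add]
        · simp only [Matrix.submatrix_apply, Matrix.of_apply, Fin.succAbove_last, Fin.val_castSucc,
            Fin.val_last, Fin.val_zero]
          congr 1
          rw [if_pos (by omega)]
          omega
      · convert ih using 2
        · ext a b
          simp
        · ext a b
          simp

/-! ### The determinant of the polynomials `c_k` -/

theorem X_sq_mul_monicC {q : ℂ} (hq : ∀ k : ℕ, 1 ≤ k → q ^ k ≠ 1) (k : ℕ) :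
    X ^ 2 * monicC q (k + 2) = monicC q (k + 4) +
      C (recCoeff q (k + 3) + recCoeff q (k + 2)) * monicC q (k + 2) +
        C (recCoeff q (k + 2) * recCoeff q (k + 1)) * monicC q k := by
  have h1 := monicC_add_two hq k
  have h2 := monicC_add_two hq (k + 1)
  have h3 := monicC_add_two hq (k + 2)
  simp only [C_add, C_mul]
  linear_combination (-1 : ℂ[X]) * h3 - X * h2 - C (recCoeff q (k + 2)) * h1

theorem recCoeff_mul_recCoeff {q : ℂ} (hq : ∀ k : ℕ, 1 ≤ k → q ^ k ≠ 1) (k : ℕ) :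
    recCoeff q (k + 2) * recCoeff q (k + 1) =
      qRatio q k * qRatio q (k + 1 : ℕ) / (qRatio q (k + 2 : ℕ) * qRatio q (k + 3 : ℕ)) := by
  have e1 := qRatio_succ hq k
  have e2 : qRatio q (k + 2 : ℕ) = qRatio q (k + 1 : ℕ) * ((1 + q ^ (k + 2)) / (1 - q ^ (k + 2))) :=
    qRatio_succ hq (k + 1)
  have e3 : qRatio q (k + 3 : ℕ) = qRatio q (k + 2 : ℕ) * ((1 + q ^ (k + 3)) / (1 - q ^ (k + 3))) :=
    qRatio_succ hq (k + 2)
  have hw := qRatio_ne_zero hq k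
  have a1 := one_sub_pow_ne_zero hq (k := k + 1) (by omega)
  have a2 := one_sub_pow_ne_zero hq (k := k + 2) (by omega)
  have a3 := one_sub_pow_ne_zero hq (k := k + 3) (by omega)
  have b1 := one_add_pow_ne_zero hq (k + 1)
  have b2 := one_add_pow_ne_zero hq (k + 2)
  have b3 := one_add_pow_ne_zero hq (k + 3)
  rw [e3, e2, e1, recCoeff, recCoeff, show k + 2 + 1 = k + 3 from rfl,
    show k + 1 + 1 = k + 2 from rfl]
  field_simp

/-- The determinant in powers of `x ^ 2` times `c_{n-1}`, `c_{n+1}`, expressed through the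
polynomials `c_k` themselves by means of the three-term recurrence. -/
theorem det_pairPowMatrix_monicC {q : ℂ} (hq : ∀ k : ℕ, 1 ≤ k → q ^ k ≠ 1) {n r : ℕ}
    (hr : 2 * r ≤ n + 1) (x : Fin (2 * r) → ℂ) :
    (-(qRatio q n * qRatio q ((n : ℤ) - 1))) ^ r *
      (pairPowMatrix (fun i => (monicC q (n - 1)).eval (x i))
        (fun i => (monicC q (n + 1)).eval (x i)) (fun i => x i ^ 2)).det =
    (-1) ^ r * (∏ i ∈ Finset.range (2 * r), qRatio q ((n : ℤ) - i)) *
      (Matrix.of fun i p : Fin (2 * r) =>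
        (monicC q (n + 1 - 2 * r + 2 * (p : ℕ))).eval (x i)).det := by
  rcases Nat.eq_zero_or_pos r with rfl | hr0
  · simp
  obtain ⟨N, rfl⟩ : ∃ N, n = N + 1 := ⟨n - 1, by omega⟩
  have hN : ((N + 1 : ℕ) : ℤ) - 1 = N := by push_cast; ring
  rw [hN, Nat.add_sub_cancel]
  -- the columns `c_{n-1}, c_{n+1}, x ^ 2 c_{n-1}, x ^ 2 c_{n+1}, …`
  let d : ℕ → ℂ[X] := fun j =>
    (X ^ 2) ^ (j / 2) * (if j % 2 = 0 then monicC q N else monicC q (N + 2))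
  -- the columns `c_{n-1}, c_{n+1}, c_{n-3}, c_{n+3}, …`
  let e : ℕ → ℂ[X] := fun j => if j % 2 = 0 then monicC q (N - j) else monicC q (N + 1 + j)
  let μ : ℕ → ℂ := fun j => if j % 2 = 0 then
    qRatio q ((N : ℤ) - j) * qRatio q ((N : ℤ) + 1 - j) / (qRatio q N * qRatio q (N + 1 : ℕ)) else 1
  let lam : ℕ → ℂ := fun j => if j % 2 = 0 then recCoeff q (N - j) * recCoeff q (N - j - 1) else 1
  have hw := qRatio_ne_zero hq N
  have hw1 := qRatio_ne_zero hq (N + 1)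
  have hspan : ∀ i j, i < j → e i ∈ Submodule.span ℂ (e '' (Finset.range j : Set ℕ)) :=
    fun i j hij => Submodule.subset_span ⟨i, by simpa using hij, rfl⟩
  have htri := sub_mem_span_of_two_step (m := 2 * r) (X ^ 2 : ℂ[X]) d e μ lam
    (by simp only [μ]
        rw [if_pos trivial]
        push_cast at hw1 ⊢
        rw [sub_zero, sub_zero]
        field_simp)
    (by simp [μ])
    (by
      intro j hj
      simp only [μ, lam]
      rw [show (j + 2) % 2 = j % 2 by omega]
      split_ifs with hj2
      · obtain ⟨k, hk⟩ : ∃ k, N = k + 2 + j := ⟨N - 2 - j, by omega⟩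
        have h := recCoeff_mul_recCoeff hq k
        rw [show N - j = k + 2 by omega, show k + 2 - 1 = k + 1 by omega, h,
          show (N : ℤ) - (j + 2 : ℕ) = k by omega, show (N : ℤ) + 1 - (j + 2 : ℕ) = (k + 1 : ℕ) by omega,
          show (N : ℤ) - j = (k + 2 : ℕ) by omega, show (N : ℤ) + 1 - j = (k + 3 : ℕ) by omega]
        have h2 := qRatio_ne_zero hq (k + 2)
        have h3 := qRatio_ne_zero hq (k + 3)
        field_simp
      · simp)
    (by simp [d, e]) (by simp [d, e])
    (by
      intro j
      simp only [d]
      rw [show (j + 2) % 2 = j % 2 by omega, show (j + 2) / 2 = j / 2 + 1 by omega]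
      ring)
    (by
      intro j hj
      have hmem : ∀ i (c : ℂ), i < j + 2 →
          C c * e i ∈ Submodule.span ℂ (e '' (Finset.range (j + 2) : Set ℕ)) := by
        intro i c hi
        rw [← smul_eq_C_mul]
        exact Submodule.smul_mem _ _ (hspan i _ hi)
      have hj2 : j % 2 = 0 ∨ j % 2 = 1 := by omega
      rcases hj2 with hj2 | hj2
      · obtain ⟨k, hk⟩ : ∃ k, N = k + 2 + j := ⟨N - 2 - j, by omega⟩
        have ej : e j = monicC q (k + 2) := by
          simp only [e]; rw [if_pos hj2]; congr 1; omega
        have ej2 : e (j + 2) = monicC q k := by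
          simp only [e]; rw [if_pos (by omega)]; congr 1; omega
        have hlam : lam j = recCoeff q (k + 2) * recCoeff q (k + 1) := by
          simp only [lam]; rw [if_pos hj2, show N - j = k + 2 by omega]; rfl
        obtain ⟨i, hi, ei⟩ : ∃ i, i < j + 2 ∧ e i = monicC q (k + 4) := by
          rcases Nat.eq_zero_or_pos j with rfl | hj0
          · exact ⟨1, by omega, by simp only [e]; rw [if_neg (by omega)]; congr 1; omega⟩
          · exact ⟨j - 2, by omega, by simp only [e]; rw [if_pos (by omega)]; congr 1; omega⟩
        have h := X_sq_mul_monicC hq k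
        have : X ^ 2 * e j - lam j • e (j + 2) =
            C 1 * e i + C (recCoeff q (k + 3) + recCoeff q (k + 2)) * e j := by
          rw [ej, ej2, ei, hlam, h, smul_eq_C_mul, C_1]; ring
        rw [this]
        exact Submodule.add_mem _ (hmem i _ hi) (hmem j _ (by omega))
      · have ej : e j = monicC q (N + 1 + j) := by
          simp only [e]; rw [if_neg (by omega)]
        have ej2 : e (j + 2) = monicC q (N + 1 + j + 2) := by
          simp only [e]; rw [if_neg (by omega)]; rfl
        have hlam : lam j = 1 := by
          simp only [lam]; rw [if_neg (by omega)]
        obtain ⟨k, hk⟩ : ∃ k, N + 1 + j = k + 2 := ⟨N + 1 + j - 2, by omega⟩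
        obtain ⟨i, hi, ei⟩ : ∃ i, i < j + 2 ∧ e i = monicC q k := by
          by_cases hj0 : j = 1
          · exact ⟨0, by omega, by simp only [e]; rw [if_pos trivial]; congr 1; omega⟩
          · exact ⟨j - 2, by omega, by simp only [e]; rw [if_neg (by omega)]; congr 1; omega⟩
        have h := X_sq_mul_monicC hq k
        have : X ^ 2 * e j - lam j • e (j + 2) =
            C (recCoeff q (k + 3) + recCoeff q (k + 2)) * e j +
              C (recCoeff q (k + 2) * recCoeff q (k + 1)) * e i := by
          rw [ej, ej2, ei, hlam, hk, h, one_smul]; ring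
        rw [this]
        exact Submodule.add_mem _ (hmem j _ (by omega)) (hmem i _ hi))
  have hdet := det_eq_of_triangular (m := 2 * r) (fun i => (Polynomial.leval (x i))) d e μ htri
  have hsort := det_outward_eq_det_sorted r fun z i => (monicC q (N + 2 + 2 * z).toNat).eval (x i)
  have hM1 : pairPowMatrix (fun i => (monicC q N).eval (x i))
        (fun i => (monicC q (N + 1 + 1)).eval (x i)) (fun i => x i ^ 2) =
      Matrix.of fun i j : Fin (2 * r) => (Polynomial.leval (x i)) (d j) := by
    ext i j
    simp only [pairPowMatrix, d, Matrix.of_apply, leval_apply, eval_mul, eval_pow, eval_X]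
    split_ifs <;> ring
  have hM2 : (Matrix.of fun i j : Fin (2 * r) => (Polynomial.leval (x i)) (e j)) =
      Matrix.of fun i j : Fin (2 * r) => (monicC q ((N : ℤ) + 2 + 2 *
        (if (j : ℕ) % 2 = 0 then -(((j : ℕ) / 2 : ℕ) : ℤ) - 1
          else (((j : ℕ) / 2 : ℕ) : ℤ))).toNat).eval (x i) := by
    ext i j
    have := j.2
    simp only [e, Matrix.of_apply, leval_apply]
    split_ifs <;> congr 2 <;> omega
  have hM3 : (Matrix.of fun i p : Fin (2 * r) =>
      (monicC q (N + 1 + 1 - 2 * r + 2 * (p : ℕ))).eval (x i)) =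
      Matrix.of fun i p : Fin (2 * r) =>
        (monicC q ((N : ℤ) + 2 + 2 * ((p : ℕ) - r)).toNat).eval (x i) := by
    ext i p
    simp only [Matrix.of_apply]
    congr 2
    omega
  have hprod : ∀ r, (qRatio q (N + 1 : ℕ) * qRatio q N) ^ r * ∏ j ∈ Finset.range (2 * r), μ j =
      ∏ i ∈ Finset.range (2 * r), qRatio q ((N + 1 : ℕ) - (i : ℤ)) := by
    intro r
    induction r with
    | zero => simp
    | succ r ih =>
      rw [show 2 * (r + 1) = 2 * r + 1 + 1 by ring, Finset.prod_range_succ, Finset.prod_range_succ,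
        Finset.prod_range_succ, Finset.prod_range_succ, ← ih]
      have hμ1 : μ (2 * r + 1) = 1 := by
        simp only [μ]; rw [if_neg (by omega)]
      have hμ0 : μ (2 * r) = qRatio q ((N : ℤ) - (2 * r : ℕ)) *
          qRatio q ((N : ℤ) + 1 - (2 * r : ℕ)) / (qRatio q N * qRatio q (N + 1 : ℕ)) := by
        simp only [μ]; rw [if_pos (by omega)]
      rw [hμ0, hμ1]
      generalize ∏ j ∈ Finset.range (2 * r), μ j = M
      rw [show ((N + 1 : ℕ) : ℤ) - (2 * r + 1 : ℕ) = N - (2 * r : ℕ) by omega,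
        show ((N + 1 : ℕ) : ℤ) - (2 * r : ℕ) = N + 1 - (2 * r : ℕ) by omega]
      field_simp
      ring
  rw [hM1, hdet, hM2, hM3]
  rw [hsort, ← hprod, neg_pow]
  ring

/-! ### The multivariable sum -/

/-- The sum defining `P_n`, in the variables `t_i = -x_i` and with the prefactor absorbed. -/
noncomputable def pairSum (q : ℂ) (n : ℕ) {m : ℕ} (t : Fin m → ℂ) : ℂ :=
  ∑ k : Fin m → Fin (n + 1),
    (∏ i : Fin m, ∏ j ∈ Finset.Ioi i,
      (q ^ (k j : ℕ) - q ^ (k i : ℕ)) / (q ^ (k j : ℕ) + q ^ (k i : ℕ))) *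
    ∏ i : Fin m, qRatio q (k i : ℕ) * qRatio q (n - (k i : ℕ)) * t i ^ (k i : ℕ)

theorem qPoch_inv_div {q : ℂ} (hq0 : q ≠ 0) (hq : ∀ k : ℕ, 1 ≤ k → q ^ k ≠ 1) {n : ℕ} :
    ∀ k ≤ n, qRatio q n * (qPoch (q ^ n)⁻¹ q k / qPoch (-(q ^ n)⁻¹) q k) =
      (-1) ^ k * qRatio q (n - k)
  | 0, _ => by simp [qPoch]
  | k + 1, h => by
    have ih := qPoch_inv_div hq0 hq (n := n) k (by omega)
    obtain ⟨d, rfl⟩ := Nat.exists_eq_add_of_le h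
    have e1 : ((k + 1 + d : ℕ) : ℤ) - k = (d + 1 : ℕ) := by omega
    have e2 : ((k + 1 + d : ℕ) : ℤ) - (k + 1 : ℕ) = d := by omega
    rw [e1, qRatio_succ hq] at ih
    rw [e2, qPoch, qPoch, Finset.prod_range_succ, Finset.prod_range_succ, ← qPoch, ← qPoch,
      mul_div_mul_comm, ← mul_assoc, ih]
    have a := one_sub_pow_ne_zero hq (k := d + 1) (by omega)
    have b := one_add_pow_ne_zero hq (d + 1)
    have hk : q ^ k ≠ 0 := pow_ne_zero _ hq0
    have hd : q ^ (d + 1) ≠ 0 := pow_ne_zero _ hq0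
    have e3 : q ^ (k + 1 + d) = q ^ k * q ^ (d + 1) := by rw [← pow_add]; congr 1; omega
    have e4 : 1 - (q ^ (k + 1 + d))⁻¹ * q ^ k = -(1 - q ^ (d + 1)) / q ^ (d + 1) := by
      rw [e3]; field_simp; ring
    have e5 : 1 - -(q ^ (k + 1 + d))⁻¹ * q ^ k = (1 + q ^ (d + 1)) / q ^ (d + 1) := by
      rw [e3]; field_simp; ring
    rw [e4, e5]
    field_simp
    ring

theorem multiP_eq_pairSum {q : ℂ} (hq0 : q ≠ 0) (hq : ∀ k : ℕ, 1 ≤ k → q ^ k ≠ 1) (n : ℕ) {m : ℕ}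
    (x : Fin m → ℂ) : multiP q n x = pairSum q n fun i => -x i := by
  rw [multiP, pairSum, Finset.mul_sum]
  refine Finset.sum_congr rfl fun k _ => ?_
  have h : (qPoch (-q) q n ^ m / qPoch q q n ^ m) = ∏ _i : Fin m, qRatio q n := by
    rw [Finset.prod_const, Finset.card_univ, Fintype.card_fin, qRatio_natCast, div_pow]
  rw [mul_left_comm, h, ← Finset.prod_mul_distrib]
  congr 1
  refine Finset.prod_congr rfl fun i _ => ?_
  have h2 := qPoch_inv_div hq0 hq (n := n) (k i) (by omega)
  rw [mul_div_mul_comm, ← qRatio_natCast, neg_pow (x i)]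
  linear_combination qRatio q (k i : ℕ) * x i ^ (k i : ℕ) * h2

/-- Even number of variables, in general position: by Schur's Pfaffian identity the sum is the
Pfaffian of its two-variable cases, and these are known. -/
theorem pairSum_mul_prod_of_even {q : ℂ} (hq0 : q ≠ 0) (hq : ∀ k : ℕ, 1 ≤ k → q ^ k ≠ 1) {n r : ℕ}
    (hr : 2 * r ≤ n + 1) (s : Fin (2 * r) → ℂ) (hs : ∀ i, s i ≠ 0)
    (hs2 : ∀ i j, i ≠ j → s i ^ 2 * s j ^ 2 ≠ 1 ∧ s i ^ 2 ≠ s j ^ 2) :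
    pairSum q n (fun i => s i ^ 2) *
        (∏ i, ∏ j ∈ Finset.Ioi i, (s i * s j - (s i * s j)⁻¹)) =
      (-1) ^ r * (∏ i ∈ Finset.range (2 * r), qRatio q ((n : ℤ) - i)) * (∏ i, s i ^ n) *
        (Matrix.of fun i p : Fin (2 * r) =>
          (monicC q (n + 1 - 2 * r + 2 * (p : ℕ))).eval (s i + (s i)⁻¹)).det := by
  rcases Nat.eq_zero_or_pos r with rfl | hr0
  · simp [pairSum]
  obtain ⟨N, rfl⟩ : ∃ N, n = N + 1 := ⟨n - 1, by omega⟩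
  have hm : Even (2 * r) := even_two_mul r
  have h1 : pairSum q (N + 1) (fun i => s i ^ 2) = pfaffian (2 * r) fun i j =>
      ∑ a : Fin (N + 2), ∑ b : Fin (N + 2),
        (q ^ (b : ℕ) - q ^ (a : ℕ)) / (q ^ (b : ℕ) + q ^ (a : ℕ)) *
          (qRatio q (a : ℕ) * qRatio q ((N + 1 : ℕ) - (a : ℕ)) * (s i ^ 2) ^ (a : ℕ)) *
          (qRatio q (b : ℕ) * qRatio q ((N + 1 : ℕ) - (b : ℕ)) * (s j ^ 2) ^ (b : ℕ)) := by
    rw [← sum_pfaffian_mul_prod (fun a b : Fin (N + 2) =>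
      (q ^ (b : ℕ) - q ^ (a : ℕ)) / (q ^ (b : ℕ) + q ^ (a : ℕ))) (2 * r) hm (fun i a =>
        qRatio q (a : ℕ) * qRatio q ((N + 1 : ℕ) - (a : ℕ)) * (s i ^ 2) ^ (a : ℕ)), pairSum]
    refine Finset.sum_congr rfl fun k _ => ?_
    rw [schur_pfaffian hm (fun i => q ^ (k i : ℕ)) fun i j _ => pow_add_pow_ne_zero hq hq0 _ _]
  have h2 : pairSum q (N + 1) (fun i => s i ^ 2) = pfaffian (2 * r) fun i j =>
      (-(qRatio q (N + 1 : ℕ) * qRatio q N)) * s i ^ (N + 1) * s j ^ (N + 1) *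
        (((monicC q N).eval (s i + (s i)⁻¹) * (monicC q (N + 2)).eval (s j + (s j)⁻¹) -
          (monicC q (N + 2)).eval (s i + (s i)⁻¹) * (monicC q N).eval (s j + (s j)⁻¹)) /
            (s i * s j - (s i * s j)⁻¹)) := by
    rw [h1]
    refine pfaffian_congr _ fun i j hij => ?_
    have h := sum_pair_eq hq0 hq N (s i ^ 2) (s j ^ 2)
    have hne : s i ^ 2 * s j ^ 2 - 1 ≠ 0 := sub_ne_zero.mpr (hs2 i j hij.ne).1
    have hw0 := qRatio_ne_zero hq N
    have hw1 := qRatio_ne_zero hq (N + 1)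
    have hw2 := qRatio_ne_zero hq (N + 2)
    have hf : ∀ M i, genF q M (s i ^ 2) =
        qRatio q M * (s i ^ M * (monicC q M).eval (s i + (s i)⁻¹)) := by
      intro M i
      rw [pow_mul_monicC_eval q M (s i) (hs i), mul_div_cancel₀ _ (qRatio_ne_zero hq M)]
    have hww : (1 - q ^ (N + 2)) / (1 + q ^ (N + 2)) = qRatio q (N + 1 : ℕ) / qRatio q (N + 2 : ℕ) := by
      have a := one_sub_pow_ne_zero hq (k := N + 2) (by omega)
      have b := one_add_pow_ne_zero hq (N + 2)
      have e : qRatio q (N + 2 : ℕ) =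
          qRatio q (N + 1 : ℕ) * ((1 + q ^ (N + 2)) / (1 - q ^ (N + 2))) := qRatio_succ hq (N + 1)
      rw [e]
      field_simp
    rw [hww, hf, hf, hf, hf] at h
    have hω : s i * s j - (s i * s j)⁻¹ = (s i ^ 2 * s j ^ 2 - 1) / (s i * s j) := by
      have := hs i
      have := hs j
      field_simp
    have hi := hs i
    have hj := hs j
    rw [hω]
    refine mul_left_cancel₀ hne (h.trans ?_)
    field_simp
    ring
  have h3 := pfaffian_inv_pairs hm (fun s => (monicC q N).eval (s + s⁻¹))
    (fun s => (monicC q (N + 2)).eval (s + s⁻¹)) s hs hs2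
  have h4 := det_pairPowMatrix_monicC hq hr fun i => s i + (s i)⁻¹
  rw [show ((N + 1 : ℕ) : ℤ) - 1 = N by omega, Nat.add_sub_cancel] at h4
  rw [h2, pfaffian_smul _ (2 * r) (fun i => s i ^ (N + 1)), Nat.mul_div_cancel_left _ (by norm_num),
    mul_assoc, h3]
  linear_combination (∏ i, s i ^ (N + 1)) * h4

theorem prod_pairs_mul {M : Type*} [CommMonoid M] : ∀ {m : ℕ} (v : Fin m → M),
    ∏ i, ∏ j ∈ Finset.Ioi i, (v i * v j) = ∏ i, v i ^ (m - 1)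
  | 0, _ => by simp
  | 1, v => by simp
  | m + 2, v => by
    rw [prod_pairs_succ, prod_pairs_mul (m := m + 1) fun i => v i.succ, Fin.prod_univ_succ (fun i => v i ^ (m + 2 - 1)),
      Finset.prod_mul_distrib, Finset.prod_const, Finset.card_univ, Fintype.card_fin, mul_assoc,
      ← Finset.prod_mul_distrib]
    congr 1
    refine Finset.prod_congr rfl fun i _ => ?_
    rw [← pow_succ']
    rfl

theorem prod_pairs_neg_one : ∀ m : ℕ,
    ∏ i : Fin m, ∏ _j ∈ Finset.Ioi i, (-1 : ℂ) = (-1) ^ (m / 2)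
  | 0 => by simp
  | 1 => by simp
  | m + 2 => by
    rw [prod_pairs_succ, prod_pairs_succ, prod_pairs_neg_one m]
    simp only [Finset.prod_const, Finset.card_univ, Fintype.card_fin]
    rw [show (m + 2) / 2 = m / 2 + 1 by omega, ← mul_assoc, ← pow_add,
      show m + 1 + m = 2 * m + 1 by ring, pow_add, pow_mul]
    ring

/-- The determinant on the right-hand side, as a polynomial function of `t_i = s_i ^ 2`. -/
noncomputable def genDet (q : ℂ) (n : ℕ) {m : ℕ} (t : Fin m → ℂ) : ℂ :=
  (Matrix.of fun i p : Fin m => t i ^ (m - 1 - (p : ℕ)) *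
    (genF q (n + 1 - m + 2 * p) (t i) / qRatio q (n + 1 - m + 2 * p : ℕ))).det

theorem genDet_sq {q : ℂ} {n m : ℕ} (hm : m ≤ n + 1) (s : Fin m → ℂ) (hs : ∀ i, s i ≠ 0) :
    genDet q n (fun i => s i ^ 2) = (∏ i, s i ^ (n + m - 1)) *
      (Matrix.of fun i p : Fin m =>
        (monicC q (n + 1 - m + 2 * (p : ℕ))).eval (s i + (s i)⁻¹)).det := by
  rw [genDet, ← Matrix.det_mul_column]
  congr 1
  ext i p
  simp only [Matrix.of_apply]
  rw [← pow_mul_monicC_eval q _ (s i) (hs i), ← pow_mul, ← mul_assoc, ← pow_add]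
  congr 2
  omega

theorem pairSum_eq_genDet_of_general_position {q : ℂ} (hq0 : q ≠ 0)
    (hq : ∀ k : ℕ, 1 ≤ k → q ^ k ≠ 1) {n r : ℕ} (hr : 2 * r ≤ n + 1) (t : Fin (2 * r) → ℂ)
    (ht : ∀ i, t i ≠ 0) (ht2 : ∀ i j, i ≠ j → t i * t j ≠ 1 ∧ t i ≠ t j) :
    pairSum q n t * (∏ i, ∏ j ∈ Finset.Ioi i, (t i * t j - 1)) =
      (-1) ^ r * (∏ i ∈ Finset.range (2 * r), qRatio q ((n : ℤ) - i)) * genDet q n t := by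
  have hsq : ∀ i, ∃ s, s ^ 2 = t i := fun i => IsAlgClosed.exists_pow_nat_eq (t i) (by norm_num)
  choose s hs using hsq
  obtain rfl : (fun i => s i ^ 2) = t := funext hs
  have hs0 : ∀ i, s i ≠ 0 := fun i h => ht i (by simp [h])
  have h := pairSum_mul_prod_of_even hq0 hq hr s hs0 ht2
  have h1 : (∏ i, ∏ j ∈ Finset.Ioi i, (s i ^ 2 * s j ^ 2 - 1)) =
      (∏ i, ∏ j ∈ Finset.Ioi i, (s i * s j - (s i * s j)⁻¹)) * ∏ i, s i ^ (2 * r - 1) := by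
    rw [← prod_pairs_mul, ← Finset.prod_mul_distrib]
    refine Finset.prod_congr rfl fun i _ => ?_
    rw [← Finset.prod_mul_distrib]
    refine Finset.prod_congr rfl fun j _ => ?_
    have := hs0 i
    have := hs0 j
    field_simp
  rw [h1, ← mul_assoc, h, genDet_sq hr s hs0]
  have h2 : (∏ i, s i ^ (n + 2 * r - 1)) = (∏ i, s i ^ n) * ∏ i, s i ^ (2 * r - 1) := by
    rw [← Finset.prod_mul_distrib]
    refine Finset.prod_congr rfl fun i _ => ?_
    rw [← pow_add]
    congr 1
    have := i.2
    omega
  rw [h2]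
  ring

theorem continuous_genF (q : ℂ) (N : ℕ) : Continuous (genF q N) := by
  unfold genF
  fun_prop

theorem continuous_genDet_comp {q : ℂ} {n m : ℕ} {t : ℂ → Fin m → ℂ} (ht : Continuous t) :
    Continuous fun e => genDet q n (t e) := by
  unfold genDet
  refine Continuous.matrix_det (continuous_matrix fun i p => ?_)
  have h : Continuous fun e => t e i := (continuous_apply i).comp ht
  exact (h.pow _).mul (((continuous_genF q _).comp h).div_const _)

theorem continuous_pairSum_comp {q : ℂ} {n m : ℕ} {t : ℂ → Fin m → ℂ} (ht : Continuous t) :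
    Continuous fun e => pairSum q n (t e) := by
  have h : ∀ i, Continuous fun e => t e i := fun i => (continuous_apply i).comp ht
  unfold pairSum
  exact continuous_finsetSum _ fun k _ => continuous_const.mul
    (continuous_finsetProd _ fun i _ => continuous_const.mul ((h i).pow _))

theorem pairSum_eq_genDet_of_even {q : ℂ} (hq0 : q ≠ 0)
    (hq : ∀ k : ℕ, 1 ≤ k → q ^ k ≠ 1) {n r : ℕ} (hr : 2 * r ≤ n + 1) (t : Fin (2 * r) → ℂ) :
    pairSum q n t * (∏ i, ∏ j ∈ Finset.Ioi i, (t i * t j - 1)) =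
      (-1) ^ r * (∏ i ∈ Finset.range (2 * r), qRatio q ((n : ℤ) - i)) * genDet q n t := by
  obtain ⟨p, hp0, hp⟩ := exists_poly_general_position t
  have hc : Continuous fun (e : ℂ) (i : Fin (2 * r)) => t i + e * ((i : ℕ) + 1) := by fun_prop
  have hcp : Continuous fun e : ℂ => ∏ i : Fin (2 * r), ∏ j ∈ Finset.Ioi i,
      ((t i + e * ((i : ℕ) + 1)) * (t j + e * ((j : ℕ) + 1)) - 1) := by fun_prop
  have h := eq_at_zero_of_eq_off_roots
    ((continuous_pairSum_comp (q := q) (n := n) hc).mul hcp).continuousAt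
    ((continuous_const (y := (-1) ^ r * (∏ i ∈ Finset.range (2 * r), qRatio q ((n : ℤ) - i)))).mul
      (continuous_genDet_comp (q := q) (n := n) hc)).continuousAt hp0
    (fun e he => pairSum_eq_genDet_of_general_position hq0 hq hr _ (hp e he).1
      fun i j hij => ⟨((hp e he).2 i j hij).2.2.1, ((hp e he).2 i j hij).1⟩)
  simpa using h

/-- Setting one variable to `0` lowers both `n` and the number of variables by one: only `k_0 = 0`
survives, and its pair factors turn `w_k` into `w_{k-1}`, as `w_k (1 - q^k) = w_{k-1} (1 + q^k)`. -/
theorem pairSum_cons_zero {q : ℂ} (hq0 : q ≠ 0) (hq : ∀ k : ℕ, 1 ≤ k → q ^ k ≠ 1) (n : ℕ) {m : ℕ}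
    (t : Fin m → ℂ) :
    pairSum q (n + 1) (Fin.cons 0 t : Fin (m + 1) → ℂ) =
      (-1) ^ m * qRatio q (n + 1 : ℕ) * (∏ i, t i) * pairSum q n t := by
  rw [pairSum, ← (Fin.consEquiv (fun _ : Fin (m + 1) => Fin (n + 1 + 1))).sum_comp,
    Fintype.sum_prod_type, Finset.sum_eq_single 0]
  rotate_left
  · intro a _ ha
    refine Finset.sum_eq_zero fun k _ => ?_
    have ha' : (a : ℕ) ≠ 0 := fun h => ha (Fin.ext h)
    rw [Fin.prod_univ_succ (fun i : Fin (m + 1) => qRatio q _ * qRatio q _ * _)]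
    simp [ha']
  · simp
  rw [pairSum, Finset.mul_sum]
  have hterm : ∀ k : Fin m → Fin (n + 1 + 1),
      (∏ i : Fin (m + 1), ∏ j ∈ Finset.Ioi i,
        (q ^ (((Fin.consEquiv fun _ => Fin (n + 1 + 1)) (0, k) : Fin (m + 1) → _) j : ℕ) -
          q ^ (((Fin.consEquiv fun _ => Fin (n + 1 + 1)) (0, k) : Fin (m + 1) → _) i : ℕ)) /
        (q ^ (((Fin.consEquiv fun _ => Fin (n + 1 + 1)) (0, k) : Fin (m + 1) → _) j : ℕ) +
          q ^ (((Fin.consEquiv fun _ => Fin (n + 1 + 1)) (0, k) : Fin (m + 1) → _) i : ℕ))) *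
      ∏ i : Fin (m + 1),
        qRatio q (((Fin.consEquiv fun _ => Fin (n + 1 + 1)) (0, k) : Fin (m + 1) → _) i : ℕ) *
        qRatio q ((n + 1 : ℕ) -
          (((Fin.consEquiv fun _ => Fin (n + 1 + 1)) (0, k) : Fin (m + 1) → _) i : ℕ)) *
        (Fin.cons 0 t : Fin (m + 1) → ℂ) i ^
          (((Fin.consEquiv fun _ => Fin (n + 1 + 1)) (0, k) : Fin (m + 1) → _) i : ℕ) =
      (-1) ^ m * qRatio q (n + 1 : ℕ) * ((∏ i : Fin m, ∏ j ∈ Finset.Ioi i,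
        (q ^ (k j : ℕ) - q ^ (k i : ℕ)) / (q ^ (k j : ℕ) + q ^ (k i : ℕ))) *
        ∏ i, qRatio q ((k i : ℕ) - 1) * qRatio q ((n + 1 : ℕ) - (k i : ℕ)) * t i ^ (k i : ℕ)) := by
    intro k
    rw [prod_pairs_succ, Fin.prod_univ_succ (fun i : Fin (m + 1) => qRatio q _ * qRatio q _ * _)]
    simp only [Fin.consEquiv_apply, Fin.cons_zero, Fin.cons_succ, Fin.val_zero, pow_zero, mul_one,
      Nat.cast_zero, sub_zero, qRatio_zero, one_mul]
    have h1 : (∏ i : Fin m, (q ^ (k i : ℕ) - 1) / (q ^ (k i : ℕ) + 1)) *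
        (∏ i, qRatio q (k i : ℕ) * qRatio q ((n + 1 : ℕ) - (k i : ℕ)) * t i ^ (k i : ℕ)) =
        (-1) ^ m * ∏ i, qRatio q ((k i : ℕ) - 1) * qRatio q ((n + 1 : ℕ) - (k i : ℕ)) *
          t i ^ (k i : ℕ) := by
      have hm : ((-1 : ℂ)) ^ m = ∏ _i : Fin m, (-1 : ℂ) := by simp
      rw [hm, ← Finset.prod_mul_distrib, ← Finset.prod_mul_distrib]
      refine Finset.prod_congr rfl fun i _ => ?_
      obtain ⟨ρ, e1, e2⟩ := exists_qRatio_pair hq (k i)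
      have hb := one_add_pow_ne_zero hq (k i)
      rw [add_comm] at hb
      rw [e1, e2]
      field_simp
      ring
    linear_combination (qRatio q (n + 1 : ℕ) * (∏ i : Fin m, ∏ j ∈ Finset.Ioi i,
        (q ^ (k j : ℕ) - q ^ (k i : ℕ)) / (q ^ (k j : ℕ) + q ^ (k i : ℕ)))) * h1
  simp only [hterm]
  symm
  refine Fintype.sum_of_injective (fun (k : Fin m → Fin (n + 1)) (i : Fin m) => (k i).succ)
    (fun k l h => funext fun i => Fin.succ_injective _ (congrFun h i)) _ _ ?_ ?_
  · intro k hk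
    obtain ⟨i, hi⟩ : ∃ i, k i = 0 := by
      by_contra hne
      push Not at hne
      exact hk ⟨fun i => (k i).pred (hne i), funext fun i => Fin.succ_pred _ _⟩
    have : ∏ i, qRatio q ((k i : ℕ) - 1) * qRatio q ((n + 1 : ℕ) - (k i : ℕ)) *
        t i ^ (k i : ℕ) = 0 := by
      refine Finset.prod_eq_zero (Finset.mem_univ i) ?_
      rw [hi, qRatio_of_neg q (k := ((0 : Fin (n + 1 + 1)) : ℕ) - 1) (by simp)]
      simp
    rw [this]
    simp
  · intro k
    have h1 : ∀ i j : Fin m, (q ^ ((k j).succ : ℕ) - q ^ ((k i).succ : ℕ)) /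
        (q ^ ((k j).succ : ℕ) + q ^ ((k i).succ : ℕ)) =
        (q ^ (k j : ℕ) - q ^ (k i : ℕ)) / (q ^ (k j : ℕ) + q ^ (k i : ℕ)) := by
      intro i j
      simp only [Fin.val_succ, pow_succ, ← sub_mul, ← add_mul]
      exact mul_div_mul_right _ _ hq0
    have h2 : (∏ i, t i) * ∏ i, qRatio q (k i : ℕ) * qRatio q (n - (k i : ℕ)) * t i ^ (k i : ℕ) =
        ∏ i, qRatio q (((k i).succ : ℕ) - 1) * qRatio q ((n + 1 : ℕ) - ((k i).succ : ℕ)) *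
          t i ^ ((k i).succ : ℕ) := by
      rw [← Finset.prod_mul_distrib]
      refine Finset.prod_congr rfl fun i _ => ?_
      rw [Fin.val_succ, show (((k i : ℕ) + 1 : ℕ) : ℤ) - 1 = (k i : ℕ) by omega,
        show ((n + 1 : ℕ) : ℤ) - ((k i : ℕ) + 1 : ℕ) = n - (k i : ℕ) by omega]
      ring
    simp only [h1]
    rw [← h2]
    ring

theorem genDet_cons_zero {q : ℂ} (hq : ∀ k : ℕ, 1 ≤ k → q ^ k ≠ 1) (n : ℕ) {m : ℕ}
    (t : Fin m → ℂ) :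
    genDet q (n + 1) (Fin.cons 0 t : Fin (m + 1) → ℂ) =
      (-1) ^ m * (∏ i, t i) * genDet q n t := by
  rw [genDet, Matrix.det_succ_row_zero, Finset.sum_eq_single (Fin.last m)]
  · have h0 : ∀ N : ℕ, genF q N 0 = qRatio q N := by
      intro N
      rw [genF, Finset.sum_range_succ', Finset.sum_eq_zero]
      · simp [qRatio_zero]
      · intro k _; simp
    rw [mul_assoc ((-1 : ℂ) ^ m), genDet, ← Matrix.det_mul_column, Fin.val_last]
    have h1 : ∀ N : ℕ, genF q N 0 / qRatio q N = 1 := fun N => by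
      rw [h0, div_self (qRatio_ne_zero hq N)]
    congr 1
    rw [Matrix.of_apply, Fin.cons_zero, h1]
    simp only [Fin.val_last, Nat.add_sub_cancel, Nat.sub_self, pow_zero, mul_one]
    congr 1
    ext i p
    have hp := p.2
    simp only [Matrix.submatrix_apply, Matrix.of_apply, Fin.succAbove_last, Fin.cons_succ,
      Fin.val_castSucc]
    rw [show n + 1 + 1 - (m + 1) + 2 * (p : ℕ) = n + 1 - m + 2 * p by omega,
      show m + 1 - 1 - (p : ℕ) = m - 1 - p + 1 by omega]
    ring
  · intro p _ hp
    have h1 : (p : ℕ) < m := by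
      have := p.2
      have h2 : (p : ℕ) ≠ m := fun h => hp (Fin.ext (by simpa using h))
      omega
    simp only [Matrix.of_apply, Fin.cons_zero]
    rw [zero_pow (by omega)]
    simp
  · simp

/-- The polynomial form of the determinant formula. An odd number of variables is reduced to an
even one by adjoining the variable `0`. -/
theorem pairSum_eq_genDet {q : ℂ} (hq0 : q ≠ 0)
    (hq : ∀ k : ℕ, 1 ≤ k → q ^ k ≠ 1) {n m : ℕ} (hm : m ≤ n + 1) (t : Fin m → ℂ)
    (ht : ∀ i, t i ≠ 0) :
    pairSum q n t * (∏ i, ∏ j ∈ Finset.Ioi i, (t i * t j - 1)) =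
      (-1) ^ (m / 2) * (∏ i ∈ Finset.range m, qRatio q ((n : ℤ) - i)) * genDet q n t := by
  rcases Nat.even_or_odd' m with ⟨r, rfl | rfl⟩
  · rw [Nat.mul_div_cancel_left _ (by norm_num)]
    exact pairSum_eq_genDet_of_even hq0 hq hm t
  · have heven : ∀ m', m' = 2 * (r + 1) → ∀ t' : Fin m' → ℂ,
        pairSum q (n + 1) t' * (∏ i, ∏ j ∈ Finset.Ioi i, (t' i * t' j - 1)) =
          (-1) ^ (r + 1) * (∏ i ∈ Finset.range m', qRatio q ((n + 1 : ℕ) - (i : ℤ))) *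
            genDet q (n + 1) t' := by
      rintro _ rfl t'
      exact pairSum_eq_genDet_of_even hq0 hq (by omega) t'
    have h := heven (2 * r + 1 + 1) (by ring) (Fin.cons 0 t)
    have h1 := pairSum_cons_zero hq0 hq n t
    have h2 := genDet_cons_zero hq n t
    have h3 := prod_pairs_succ (m := 2 * r + 1) fun i j =>
      (Fin.cons 0 t : Fin (2 * r + 1 + 1) → ℂ) i * (Fin.cons 0 t : Fin (2 * r + 1 + 1) → ℂ) j - 1
    have h4 := Finset.prod_range_succ' (fun i : ℕ => qRatio q ((n + 1 : ℕ) - (i : ℤ))) (2 * r + 1)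
    have hodd : (-1 : ℂ) ^ (2 * r + 1) = -1 := Odd.neg_one_pow ⟨r, rfl⟩
    simp only [Fin.cons_zero, Fin.cons_succ, zero_mul, zero_sub, Finset.prod_const,
      Finset.card_univ, Fintype.card_fin, hodd] at h3
    have h5 : ∀ i : ℕ, ((n + 1 : ℕ) : ℤ) - (i + 1 : ℕ) = n - i := fun i => by omega
    simp only [h5, Nat.cast_zero, sub_zero] at h4
    rw [hodd] at h1 h2
    rw [h1, h2, h3, h4] at h
    have hP : (∏ i, t i) ≠ 0 := Finset.prod_ne_zero_iff.mpr fun i _ => ht i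
    have hw := qRatio_ne_zero hq (n + 1)
    rw [show (2 * r + 1) / 2 = r by omega]
    refine mul_left_cancel₀ (mul_ne_zero hP hw) ?_
    linear_combination h

/-! ### The determinant formula for `P_n` -/

theorem eval_rectNum (p : ℕ → ℂ[X]) (n m : ℕ) (y : Fin m → ℂ) :
    MvPolynomial.eval y (rectNum p n m) =
      (Matrix.of fun i j : Fin m => (p (n + 2 * (j : ℕ))).eval (y i)).det := by
  rw [rectNum, RingHom.map_det]
  congr 1
  ext i j
  simp only [RingHom.mapMatrix_apply, Matrix.map_apply, Matrix.of_apply]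
  rw [aeval_def, hom_eval₂, MvPolynomial.eval_X, eval, MvPolynomial.algebraMap_eq]
  congr 1
  ext; simp

theorem pairSum_eq_rectSchur_of_general_position {q : ℂ} (hq0 : q ≠ 0)
    (hq : ∀ k : ℕ, 1 ≤ k → q ^ k ≠ 1) {n m : ℕ} (hm : m ≤ n + 1) (s : Fin m → ℂ)
    (hs : ∀ i, s i ≠ 0) (hs2 : ∀ i j, i ≠ j → s i ^ 2 * s j ^ 2 ≠ 1 ∧ s i ^ 2 ≠ s j ^ 2) :
    pairSum q n (fun i => s i ^ 2) =
      (∏ i : Fin m, qRatio q ((n : ℤ) - (i : ℕ)) * s i ^ (n + 1 - m)) *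
        (∏ i : Fin m, ∏ j ∈ Finset.Ioi i, (s i ^ 2 - s j ^ 2)) *
          MvPolynomial.eval (fun i => s i + (s i)⁻¹)
            (rectSchur (monicC_parity q) (n + 1 - m) m) := by
  have hne : (∏ i, ∏ j ∈ Finset.Ioi i, (s i ^ 2 * s j ^ 2 - 1)) ≠ 0 :=
    Finset.prod_ne_zero_iff.mpr fun i _ => Finset.prod_ne_zero_iff.mpr fun j hj =>
      sub_ne_zero.mpr (hs2 i j (Finset.mem_Ioi.mp hj).ne).1
  have h := pairSum_eq_genDet hq0 hq hm (fun i => s i ^ 2) fun i => pow_ne_zero 2 (hs i)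
  have hden := congrArg (MvPolynomial.eval fun i => s i + (s i)⁻¹)
    (rectDen_mul_rectSchur (monicC_parity q) (n + 1 - m) m)
  rw [map_mul, eval_rectNum] at hden
  have h2 := genDet_sq (q := q) hm s hs
  rw [← hden] at h2
  rw [h2] at h
  refine mul_right_cancel₀ hne (h.trans ?_)
  -- `(s_j + 1 / s_j) ^ 2 - (s_i + 1 / s_i) ^ 2` factors through both kinds of differences
  have h3 : (∏ i, s i ^ (m - 1)) ^ 2 *
      MvPolynomial.eval (fun i => s i + (s i)⁻¹) (rectDen m) =
      (-1) ^ (m / 2) * (∏ i : Fin m, ∏ j ∈ Finset.Ioi i, (s i ^ 2 - s j ^ 2)) *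
        ∏ i, ∏ j ∈ Finset.Ioi i, (s i ^ 2 * s j ^ 2 - 1) := by
    rw [rectDen, ← prod_pairs_mul, ← prod_pairs_neg_one]
    simp only [map_prod, map_sub, map_pow, MvPolynomial.eval_X, ← Finset.prod_mul_distrib,
      ← Finset.prod_pow]
    refine Finset.prod_congr rfl fun i _ => Finset.prod_congr rfl fun j _ => ?_
    have hi := hs i
    have hj := hs j
    field_simp
    ring
  have h4 : (∏ i, s i ^ (n + m - 1)) =
      (∏ i, s i ^ (n + 1 - m)) * (∏ i, s i ^ (m - 1)) ^ 2 := by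
    rw [← Finset.prod_pow, ← Finset.prod_mul_distrib]
    refine Finset.prod_congr rfl fun i _ => ?_
    rw [← pow_mul, ← pow_add]
    congr 1
    have := i.2
    omega
  have h5 : ((-1 : ℂ) ^ (m / 2)) * (-1) ^ (m / 2) = 1 := by
    rw [← mul_pow]; simp
  rw [h4, Finset.prod_mul_distrib,
    Fin.prod_univ_eq_prod_range (fun i => qRatio q ((n : ℤ) - (i : ℕ))) m]
  generalize (∏ i ∈ Finset.range m, qRatio q ((n : ℤ) - (i : ℕ))) = W at *
  generalize MvPolynomial.eval (fun i => s i + (s i)⁻¹)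
    (rectSchur (monicC_parity q) (n + 1 - m) m) = S at *
  linear_combination ((-1) ^ (m / 2) * W * (∏ i, s i ^ (n + 1 - m)) * S) * h3 +
    (W * (∏ i, s i ^ (n + 1 - m)) * S *
      (∏ i : Fin m, ∏ j ∈ Finset.Ioi i, (s i ^ 2 - s j ^ 2)) *
        ∏ i, ∏ j ∈ Finset.Ioi i, (s i ^ 2 * s j ^ 2 - 1)) * h5

theorem pairSum_eq_rectSchur {q : ℂ} (hq0 : q ≠ 0)
    (hq : ∀ k : ℕ, 1 ≤ k → q ^ k ≠ 1) {n m : ℕ} (hm : m ≤ n + 1) (s : Fin m → ℂ)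
    (hs : ∀ i, s i ≠ 0) :
    pairSum q n (fun i => s i ^ 2) =
      (∏ i : Fin m, qRatio q ((n : ℤ) - (i : ℕ)) * s i ^ (n + 1 - m)) *
        (∏ i : Fin m, ∏ j ∈ Finset.Ioi i, (s i ^ 2 - s j ^ 2)) *
          MvPolynomial.eval (fun i => s i + (s i)⁻¹)
            (rectSchur (monicC_parity q) (n + 1 - m) m) := by
  obtain ⟨p, hp0, hp⟩ := exists_poly_general_position s
  have hc : Continuous fun (e : ℂ) (i : Fin m) => (s i + e * ((i : ℕ) + 1)) ^ 2 := by fun_prop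
  have hc1 : ContinuousAt (fun e : ℂ => (∏ i : Fin m, qRatio q ((n : ℤ) - (i : ℕ)) *
      (s i + e * ((i : ℕ) + 1)) ^ (n + 1 - m)) *
        (∏ i : Fin m, ∏ j ∈ Finset.Ioi i,
          ((s i + e * ((i : ℕ) + 1)) ^ 2 - (s j + e * ((j : ℕ) + 1)) ^ 2))) 0 := by fun_prop
  have hc2 : ContinuousAt (fun e : ℂ => MvPolynomial.eval
      (fun i => (s i + e * ((i : ℕ) + 1)) + (s i + e * ((i : ℕ) + 1))⁻¹)
      (rectSchur (monicC_parity q) (n + 1 - m) m)) 0 := by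
    refine ContinuousAt.comp (f := fun (e : ℂ) (i : Fin m) =>
      (s i + e * ((i : ℕ) + 1)) + (s i + e * ((i : ℕ) + 1))⁻¹)
      (MvPolynomial.continuous_eval (rectSchur (monicC_parity q) (n + 1 - m) m)).continuousAt
      (continuousAt_pi.mpr fun i => ?_)
    exact ContinuousAt.add (by fun_prop) (ContinuousAt.inv₀ (by fun_prop) (by simpa using hs i))
  have h := eq_at_zero_of_eq_off_roots
    (continuous_pairSum_comp (q := q) (n := n) hc).continuousAt (hc1.mul hc2) hp0
    (fun e he => pairSum_eq_rectSchur_of_general_position hq0 hq hm _ (hp e he).1 fun i j hij => by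
      obtain ⟨h1, h2, h3, h4⟩ := (hp e he).2 i j hij
      constructor
      · rw [← mul_pow, sq]
        exact fun h => (mul_self_eq_one_iff.mp h).elim h3 h4
      · rw [Ne, sq_eq_sq_iff_eq_or_eq_neg, not_or]
        exact ⟨h1, fun h => h2 (by rw [h]; ring)⟩)
  simpa using h

/-! ### Orthogonality of the polynomials `c_k` -/

section

variable {q : ℂ} (hq : ∀ k : ℕ, 1 ≤ k → q ^ k ≠ 1)

include hq

theorem X_mul_monicC_succ (k : ℕ) :
    X * monicC q (k + 1) = monicC q (k + 2) + C (recCoeff q (k + 1)) * monicC q k := by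
  rw [monicC_add_two hq]; ring

/-- By the three-term recurrence, a functional that kills all `c_k` with `k ≥ 1` makes the family
orthogonal. -/
theorem functional_orthogonal (L : ℂ[X] →ₗ[ℂ] ℂ) (hL : ∀ k, L (monicC q (k + 1)) = 0) :
    ∀ j k, j < k → L (monicC q j * monicC q k) = 0
  | 0, k, h => by
    obtain ⟨k, rfl⟩ : ∃ k', k = k' + 1 := ⟨k - 1, by omega⟩
    rw [monicC_zero, one_mul, hL]
  | 1, k, h => by
    obtain ⟨k, rfl⟩ : ∃ k', k = k' + 2 := ⟨k - 2, by omega⟩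
    rw [monicC_one hq, X_mul_monicC_succ hq, ← smul_eq_C_mul, map_add, map_smul, hL, hL]
    simp
  | j + 2, k, h => by
    obtain ⟨k, rfl⟩ : ∃ k', k = k' + 1 := ⟨k - 1, by omega⟩
    have h1 := functional_orthogonal L hL (j + 1) (k + 2) (by omega)
    have h2 := functional_orthogonal L hL (j + 1) k (by omega)
    have h3 := functional_orthogonal L hL j (k + 1) (by omega)
    have e : monicC q (j + 2) * monicC q (k + 1) = monicC q (j + 1) * monicC q (k + 2) +
        recCoeff q (k + 1) • (monicC q (j + 1) * monicC q k) -
          recCoeff q (j + 1) • (monicC q j * monicC q (k + 1)) := by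
      simp only [smul_eq_C_mul]
      rw [monicC_add_two hq j]
      linear_combination monicC q (j + 1) * X_mul_monicC_succ hq k
    rw [e, map_sub, map_add, map_smul, map_smul, h1, h2, h3]
    simp

theorem existsUnique_momentFunctional (c : ℂ) : ∃! L, IsMomentFunctional (monicC q) c L := by
  let S : Polynomial.Sequence ℂ := ⟨monicC q, fun i => by
    rw [degree_eq_natDegree (natDegree_monicC hq i).2.ne_zero, (natDegree_monicC hq i).1]⟩
  have hlead : ∀ i, IsUnit (S i).leadingCoeff := fun i => by
    have : (S i).leadingCoeff = 1 := (natDegree_monicC hq i).2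
    rw [this]; exact isUnit_one
  let b := S.basis hlead
  have hb : ∀ i, b i = monicC q i := fun i => S.basis_eq_self hlead i
  refine ⟨b.constr ℂ fun i => if i = 0 then c else 0, ⟨?_, ?_⟩, ?_⟩
  · have hL : ∀ k, (b.constr ℂ fun i => if i = 0 then c else 0) (monicC q (k + 1)) = 0 := fun k => by
      rw [← hb, Module.Basis.constr_basis]; simp
    intro j k hjk
    rcases lt_or_gt_of_ne hjk with h | h
    · exact functional_orthogonal hq _ hL j k h
    · rw [mul_comm]; exact functional_orthogonal hq _ hL k j h
  · rw [← monicC_zero q, ← hb, Module.Basis.constr_basis]; simp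
  · rintro L ⟨h1, h2⟩
    refine b.ext fun i => ?_
    rw [Module.Basis.constr_basis, hb]
    rcases i with _ | i
    · rw [monicC_zero, h2]; simp
    · have := h1 0 (i + 1) (by omega)
      rw [monicC_zero, one_mul] at this
      rw [this]; simp

theorem momentFunctional_sq_succ {c : ℂ} {L : ℂ[X] →ₗ[ℂ] ℂ}
    (hL : IsMomentFunctional (monicC q) c L) :
    ∀ k, L (monicC q (k + 1) ^ 2) = recCoeff q (k + 1) * L (monicC q k ^ 2)
  | 0 => by
    have h := hL.1 0 2 (by omega)
    have e : monicC q (0 + 1) ^ 2 = monicC q 0 * monicC q 2 +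
        recCoeff q (0 + 1) • monicC q 0 ^ 2 := by
      rw [smul_eq_C_mul, monicC_add_two hq 0, monicC_zero, zero_add, monicC_one hq]
      ring
    rw [e, map_add, map_smul, h]
    simp
  | k + 1 => by
    have h1 := hL.1 (k + 1) (k + 3) (by omega)
    have h2 := hL.1 k (k + 2) (by omega)
    have e : monicC q (k + 1 + 1) ^ 2 = monicC q (k + 1) * monicC q (k + 3) +
        recCoeff q (k + 1 + 1) • monicC q (k + 1) ^ 2 -
          recCoeff q (k + 1) • (monicC q k * monicC q (k + 2)) := by
      simp only [smul_eq_C_mul]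
      linear_combination monicC q (k + 2) * monicC_add_two hq k +
        monicC q (k + 1) * X_mul_monicC_succ hq (k + 1)
    rw [e, map_sub, map_add, map_smul, map_smul, h1, h2]
    simp

theorem momentFunctional_sq {L : ℂ[X] →ₗ[ℂ] ℂ}
    (hL : IsMomentFunctional (monicC q) ((1 - q) / (1 + q)) L) (k : ℕ) :
    L (monicC q k ^ 2) = (qRatio q k * qRatio q (k + 1 : ℕ))⁻¹ := by
  induction k with
  | zero =>
    have h := qRatio_succ hq 0
    rw [monicC_zero, one_pow, hL.2, h, Nat.cast_zero, qRatio_zero]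
    simp
  | succ k ih =>
    rw [momentFunctional_sq_succ hq hL, ih, recCoeff]
    have e2 : qRatio q (k + 1 + 1 : ℕ) =
      qRatio q (k + 1 : ℕ) * ((1 + q ^ (k + 2)) / (1 - q ^ (k + 2))) := qRatio_succ hq (k + 1)
    rw [e2, qRatio_succ hq k, show k + 1 + 1 = k + 2 from rfl]
    have hw := qRatio_ne_zero hq k
    have a1 := one_sub_pow_ne_zero hq (k := k + 1) (by omega)
    have a2 := one_sub_pow_ne_zero hq (k := k + 2) (by omega)
    have b1 := one_add_pow_ne_zero hq (k + 1)
    have b2 := one_add_pow_ne_zero hq (k + 2)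
    field_simp

/-- The squared norms in the Christoffel–Darboux kernel pair up the factors `w_n, …, w_{n+1-2m}`. -/
theorem prod_qRatio_eq_inv_prod_sq {L : ℂ[X] →ₗ[ℂ] ℂ}
    (hL : IsMomentFunctional (monicC q) ((1 - q) / (1 + q)) L) (n : ℕ) :
    ∀ m, 2 * m ≤ n + 1 → (∏ i ∈ Finset.range (2 * m), qRatio q ((n : ℤ) - (i : ℕ))) =
      (∏ i ∈ Finset.Icc 1 m, L (monicC q (n + 1 - 2 * i) ^ 2))⁻¹
  | 0, _ => by simp
  | m + 1, h => by
    rw [show 2 * (m + 1) = 2 * m + 1 + 1 by ring, Finset.prod_range_succ, Finset.prod_range_succ,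
      prod_qRatio_eq_inv_prod_sq hL n m (by omega), Finset.prod_Icc_succ_top (by omega), mul_inv,
      momentFunctional_sq hq hL, inv_inv,
      show (n : ℤ) - (2 * m : ℕ) = (n + 1 - 2 * (m + 1) + 1 : ℕ) by omega,
      show (n : ℤ) - (2 * m + 1 : ℕ) = (n + 1 - 2 * (m + 1) : ℕ) by omega]
    ring

end

theorem multiP_eq_rectSchur {q : ℂ} (hq0 : q ≠ 0) (hq : ∀ k : ℕ, 1 ≤ k → q ^ k ≠ 1) {n m : ℕ}
    (hm : m ≤ n + 1) (x s : Fin m → ℂ) (hx : ∀ i, x i ≠ 0) (hs : ∀ i, s i ^ 2 = -x i) :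
    multiP q n x = (∏ i ∈ Finset.range m, qRatio q ((n : ℤ) - (i : ℕ))) *
      (∏ i, s i ^ (n + 1 - m)) * (∏ i : Fin m, ∏ j ∈ Finset.Ioi i, (x j - x i)) *
        MvPolynomial.eval (fun i => s i + (s i)⁻¹)
          (rectSchur (monicC_parity q) (n + 1 - m) m) := by
  have hs0 : ∀ i, s i ≠ 0 := fun i h => hx i (by
    have := hs i
    rw [h] at this
    simpa using this.symm)
  have h := pairSum_eq_rectSchur hq0 hq hm s hs0
  rw [Finset.prod_mul_distrib,
    Fin.prod_univ_eq_prod_range (fun i => qRatio q ((n : ℤ) - (i : ℕ))) m] at h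
  simp only [hs] at h
  rw [multiP_eq_pairSum hq0 hq, h]
  congr 2
  refine Finset.prod_congr rfl fun i _ => Finset.prod_congr rfl fun j _ => ?_
  ring

theorem theorem5 (q : ℂ) (hq0 : q ≠ 0) (hq : ∀ k : ℕ, 1 ≤ k → q ^ k ≠ 1) :
    (∀ (n m : ℕ), m ≤ n + 1 →
      ∀ (x s : Fin m → ℂ), (∀ i, x i ≠ 0) → (∀ i, s i ^ 2 = -x i) →
        multiP q n x =
          (∏ i : Fin m, qPoch (-q) q (n - (i : ℕ)) / qPoch q q (n - (i : ℕ)) *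
              s i ^ (n + 1 - m)) *
            (∏ i : Fin m, ∏ j ∈ Finset.Ioi i, (x j - x i)) *
            MvPolynomial.eval (fun i => s i + (s i)⁻¹)
              (rectSchur (monicC_parity q) (n + 1 - m) m)) ∧
    (∃! L : Polynomial ℂ →ₗ[ℂ] ℂ, IsMomentFunctional (monicC q) ((1 - q) / (1 + q)) L) ∧
    (∀ L : Polynomial ℂ →ₗ[ℂ] ℂ, IsMomentFunctional (monicC q) ((1 - q) / (1 + q)) L →
      (∀ k : ℕ, L (monicC q k ^ 2) =
        (qPoch q q k * qPoch q q (k + 1)) / (qPoch (-q) q k * qPoch (-q) q (k + 1))) ∧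
      ∀ (n m : ℕ), 2 * m ≤ n + 1 →
        ∀ (x s : Fin (2 * m) → ℂ), (∀ i, x i ≠ 0) → (∀ i, s i ^ 2 = -x i) →
          multiP q n x =
            (∏ i : Fin (2 * m), s i ^ (n + 1 - 2 * m)) *
              (∏ i : Fin (2 * m), ∏ j ∈ Finset.Ioi i, (x j - x i)) *
              MvPolynomial.eval (fun i => s i + (s i)⁻¹)
                (kernelK (monicC_parity q) L n m)) := by
  refine ⟨fun n m hm x s hx hs => ?_, existsUnique_momentFunctional hq _, fun L hL => ⟨fun k => ?_,
    fun n m hm x s hx hs => ?_⟩⟩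
  · rw [multiP_eq_rectSchur hq0 hq hm x s hx hs, Finset.prod_mul_distrib,
      ← Fin.prod_univ_eq_prod_range]
    congr 3
    refine Finset.prod_congr rfl fun i _ => ?_
    rw [← qRatio_natCast]
    congr 1
    have := i.2
    omega
  · rw [momentFunctional_sq hq hL, qRatio_natCast, qRatio_natCast, div_mul_div_comm, inv_div]
  · rw [multiP_eq_rectSchur hq0 hq hm x s hx hs, prod_qRatio_eq_inv_prod_sq hq hL n m hm, kernelK,
      map_mul, MvPolynomial.eval_C]
    ring
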